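/- Let $n \ge 2000$, let $V$ be an $n$-dimensional vector space over $\mathbf{F}_2$ with a nondegenerate alternating bilinear form $f$, and let $\mathrm{Sp}_n(2)$ be the isometry group of $f$. A transvection is an element $t \in \mathrm{SL}(V)$ such that $t-1$ has rank one; it has the form $t = 1 + u \otimes \psi$, i.e. $t(x) = x + \psi(x)u$, with $u \in V$, $\psi \in V^*$, $\psi(u)=0$. A set $T$ of transvections is called dense if for all nonzero $v \in V$ and nonzero $\phi \in V^*$ there is some $t = 1 + u\otimes\psi \in T$ with $\phi(u) \ne 0$ and $\psi(v) \ne 0$. For a group $G \le \mathrm{GL}(V)$ let $[V,G]$ be the span of all $gv - v$ ($g \in G$, $v \in V$). For $m \ge 1$ let $S_m$ act on $\mathbf{F}_2^m$ by permuting coordinates, and let $\ell = \langle(1,\dots,1)\rangle$ and $H = \{x : x_1 + \cdots + x_m = 0\}$. A linear group $G \le \mathrm{GL}(U)$ over $\mathbf{F}_2$ has symmetric type if, for some $m$ and some linear isomorphism $U \cong H/(\ell\cap H)$, $G$ corresponds to the image of $S_m$ in $\mathrm{GL}(H/(\ell \cap H))$; it has odd symmetric type if moreover $m$ can be taken odd.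 Let $T \subset \mathrm{Sp}_n(2)$ be a dense set of transvections and let $G = \langle T\rangle$. Then the following are equivalent: (1) $G$ has symmetric type; (2) for every subset $T_0 \subset T$ with $|T_0| \le 1000$ such that, with $G_0 = \langle T_0\rangle$ and $V_0 = [V,G_0]$, we have $\dim V_0 \ge 2$ and $G_0$ acts irreducibly on $V_0$, the restriction $G_0|V_0 \le \mathrm{GL}(V_0)$ has odd symmetric type. -/

import Mathlib

/-!
Over `𝔽₂` every transvection of `Sp(V, f)` is `x ↦ x + f(x, u) u` for a vector `u`, so a set of
transvections is a set `S` of vectors, and the group it generates is of symmetric type exactly when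
`S` is contained in the set of edges `q i + q j` of a simplex: points `q i`, defined up to a
common translation, any two of whose distinct edges with a common endpoint are non-orthogonal. The
edges then span `V`, and their transvections act as the transpositions of the vertices.

From global to local: if few edges of a simplex generate an irreducible group, the edges lie within
one orbit of vertices, and on this block they form a smaller simplex with nondegenerate span. The
sum of all `q i + q p` over a block of even size is orthogonal to that span, so the block has odd
size.

From local to global: any few elements of `S` are contained in a bounded subset of `S` which is
connected under non-orthogonality and has nondegenerate span, since each radical vector can be
killed by adjoining one more element of `S`. By the local condition this subset generates the group
of an odd simplex. Fix `a, b ∈ S` with `f(a, b) = 1`; they share a vertex `p` in every local simplex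
containing them, and the edges through `p` are recognised by their values under `f(·, a)` and
`f(·, b)`. Hence the edges through `p` in the various local simplices fit together, and they are
the points of a global simplex, with `p` at the origin.
-/

namespace SymType

section Linear

variable {K V : Type*} [Field K] [AddCommGroup V] [Module K V]

/-- A transvection: a linear automorphism `t` of determinant `1` such that `t - 1` has rank one. -/
def IsTransvection (t : V ≃ₗ[K] V) : Prop :=
  LinearEquiv.det t = 1 ∧
    Module.finrank K (LinearMap.range ((t : V →ₗ[K] V) - LinearMap.id)) = 1

/-- A set `T` of transvections is dense if for all nonzero `v ∈ V` and nonzero `φ ∈ V*` some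
`t = 1 + u ⊗ ψ` in `T` (that is, `t x = x + ψ(x) u`) satisfies `φ(u) ≠ 0` and `ψ(v) ≠ 0`. -/
def IsDenseSet (T : Set (V ≃ₗ[K] V)) : Prop :=
  ∀ v : V, v ≠ 0 → ∀ φ : Module.Dual K V, φ ≠ 0 →
    ∃ t ∈ T, ∃ (u : V) (ψ : Module.Dual K V),
      (∀ x, t x = x + ψ x • u) ∧ φ u ≠ 0 ∧ ψ v ≠ 0

/-- The subspace `[V, G]`, spanned by all `g v - v` with `g ∈ G` and `v ∈ V`. -/
def commutatorSpace (G : Subgroup (V ≃ₗ[K] V)) : Submodule K V :=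
  Submodule.span K {x | ∃ g ∈ G, ∃ v : V, x = g v - v}

/-- The restriction `G | W`: the group of all automorphisms of `W` induced by elements of `G`.
(It is used only for `G`-invariant subspaces `W`.) -/
def restrictTo (G : Subgroup (V ≃ₗ[K] V)) (W : Submodule K V) : Subgroup (W ≃ₗ[K] W) where
  carrier := {h | ∃ g ∈ G, ∀ w : W, ((h w : W) : V) = g (w : V)}
  one_mem' := ⟨1, G.one_mem, fun _ => rfl⟩
  mul_mem' := by
    rintro a b ⟨g, hg, hga⟩ ⟨k, hk, hkb⟩
    refine ⟨g * k, G.mul_mem hg hk, fun w => ?_⟩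
    simp only [LinearEquiv.mul_apply, hga, hkb]
  inv_mem' := by
    rintro a ⟨g, hg, hga⟩
    refine ⟨g⁻¹, G.inv_mem hg, fun w => ?_⟩
    apply g.injective
    rw [← hga, ← LinearEquiv.mul_apply, ← LinearEquiv.mul_apply, mul_inv_cancel, mul_inv_cancel]
    rfl

/-- The tautological representation of a linear group `G ≤ GL(V)` on `V`. -/
def naturalRep (G : Subgroup (V ≃ₗ[K] V)) : Representation K G V where
  toFun g := ((g : V ≃ₗ[K] V) : V →ₗ[K] V)
  map_one' := rfl
  map_mul' _ _ := rfl

end Linear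

section Symmetric

/-- The standard permutation representation of `S_m` on `𝔽₂^m`: `(σ x)_i = x_{σ⁻¹ i}`. -/
def permRep (m : ℕ) : Representation (ZMod 2) (Equiv.Perm (Fin m)) (Fin m → ZMod 2) where
  toFun σ := LinearMap.funLeft (ZMod 2) (ZMod 2) (σ⁻¹ : Equiv.Perm (Fin m))
  map_one' := rfl
  map_mul' _ _ := rfl

/-- The hyperplane `H = {x : x_1 + ⋯ + x_m = 0}` of `𝔽₂^m`. -/
def sumZero (m : ℕ) : Submodule (ZMod 2) (Fin m → ZMod 2) where
  carrier := {x | ∑ i, x i = 0}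
  zero_mem' := by simp
  add_mem' := by
    intro a b ha hb
    simp only [Set.mem_ofPred_eq, Pi.add_apply, Finset.sum_add_distrib] at *
    rw [ha, hb, add_zero]
  smul_mem' := by
    intro c a ha
    simp only [Set.mem_ofPred_eq, Pi.smul_apply, ← Finset.smul_sum] at *
    rw [ha, smul_zero]

/-- The line `ℓ` spanned by `e = (1, …, 1)`. -/
def allOnes (m : ℕ) : Submodule (ZMod 2) (Fin m → ZMod 2) :=
  Submodule.span (ZMod 2) {fun _ => 1}

theorem sumZero_le_comap (m : ℕ) (σ : Equiv.Perm (Fin m)) :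
    sumZero m ≤ (sumZero m).comap (permRep m σ) := by
  intro x hx
  change ∑ i, x (σ⁻¹ i) = 0
  rw [Equiv.sum_comp (σ⁻¹ : Equiv.Perm (Fin m)) x]
  exact hx

/-- The action of `S_m` on `H`. -/
def sumZeroRep (m : ℕ) : Representation (ZMod 2) (Equiv.Perm (Fin m)) (sumZero m) :=
  (permRep m).subrepresentation (sumZero m) (sumZero_le_comap m)

/-- `ℓ ∩ H`, as a subspace of `H`. -/
def allOnesIn (m : ℕ) : Submodule (ZMod 2) (sumZero m) :=
  (allOnes m).comap (sumZero m).subtype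

theorem allOnesIn_le_comap (m : ℕ) (σ : Equiv.Perm (Fin m)) :
    allOnesIn m ≤ (allOnesIn m).comap (sumZeroRep m σ) := by
  intro x hx
  obtain ⟨c, hc⟩ := Submodule.mem_span_singleton.1 hx
  refine Submodule.mem_span_singleton.2 ⟨c, ?_⟩
  funext i
  exact congrFun hc (σ⁻¹ i)

/-- The action of `S_m` on `H / (ℓ ∩ H)`. -/
def symRep (m : ℕ) :
    Representation (ZMod 2) (Equiv.Perm (Fin m)) (sumZero m ⧸ allOnesIn m) :=
  (sumZeroRep m).quotient (allOnesIn m) (allOnesIn_le_comap m)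

variable {V : Type*} [AddCommGroup V] [Module (ZMod 2) V]

/-- Under some linear isomorphism `V ≅ H / (ℓ ∩ H)`, the linear group `G ≤ GL(V)` is exactly the
image of `S_m`. -/
def IsSymmetricOfDegree (G : Subgroup (V ≃ₗ[ZMod 2] V)) (m : ℕ) : Prop :=
  ∃ e : V ≃ₗ[ZMod 2] (sumZero m ⧸ allOnesIn m), ∀ g : V ≃ₗ[ZMod 2] V,
    g ∈ G ↔ ∃ σ : Equiv.Perm (Fin m), ∀ v : V, e (g v) = symRep m σ (e v)

/-- `G` has symmetric type. -/
def HasSymmetricType (G : Subgroup (V ≃ₗ[ZMod 2] V)) : Prop :=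
  ∃ m : ℕ, IsSymmetricOfDegree G m

/-- `G` has odd symmetric type. -/
def HasOddSymmetricType (G : Subgroup (V ≃ₗ[ZMod 2] V)) : Prop :=
  ∃ m : ℕ, Odd m ∧ IsSymmetricOfDegree G m

end Symmetric

end SymType

namespace SymType

section Intertwiners

variable {R A U V : Type*} [CommRing R] [Group A] [AddCommGroup U] [Module R U]
  [AddCommGroup V] [Module R V] {ρ : Representation R A U} {Φ : U →ₗ[R] V}

/-- The pairs `(g, a)` for which `Φ` carries the action of `a` on `U` to `g`. It is a group, so that
statements about closures of sets of generators become inclusions of subgroups. -/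
def intertwiners (ρ : Representation R A U) (Φ : U →ₗ[R] V) : Subgroup ((V ≃ₗ[R] V) × A) where
  carrier := {p | ∀ y, p.1 (Φ y) = Φ (ρ p.2 y)}
  one_mem' y := by simp
  mul_mem' {p q} hp hq y := by
    simp only [Set.mem_ofPred_eq] at hp hq
    simp [hp, hq]
  inv_mem' {p} hp y := by
    simp only [Set.mem_ofPred_eq] at hp
    apply p.1.injective
    simp [hp, ← Module.End.mul_apply, ← map_mul]

theorem mem_intertwiners {g : V ≃ₗ[R] V} {a : A} :
    (g, a) ∈ intertwiners ρ Φ ↔ ∀ y, g (Φ y) = Φ (ρ a y) := Iff.rfl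

theorem eq_of_mem_intertwiners (hΦ : Function.Surjective Φ) {g h : V ≃ₗ[R] V} {a : A}
    (hg : (g, a) ∈ intertwiners ρ Φ) (hh : (h, a) ∈ intertwiners ρ Φ) : g = h := by
  ext v
  obtain ⟨y, rfl⟩ := hΦ v
  rw [mem_intertwiners.1 hg, mem_intertwiners.1 hh]

theorem exists_mem_intertwiners (hΦ : Function.Surjective Φ)
    (hker : ∀ a, LinearMap.ker Φ ≤ (LinearMap.ker Φ).comap (ρ a)) (a : A) :
    ∃ g : V ≃ₗ[R] V, (g, a) ∈ intertwiners ρ Φ := by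
  let e := Φ.quotKerEquivOfSurjective hΦ
  let ρ' := ρ.quotient (LinearMap.ker Φ) hker
  have hinv (b : A) : ρ' b ∘ₗ ρ' b⁻¹ = LinearMap.id := by
    rw [← Module.End.mul_eq_comp, ← map_mul, mul_inv_cancel, map_one, Module.End.one_eq_id]
  let s : (U ⧸ LinearMap.ker Φ) ≃ₗ[R] U ⧸ LinearMap.ker Φ :=
    .ofLinearMap (ρ' a) (ρ' a⁻¹) (hinv a) (by simpa using hinv a⁻¹)
  refine ⟨(e.symm.trans s).trans e, mem_intertwiners.2 fun y => ?_⟩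
  change e (s (e.symm (e (Submodule.Quotient.mk y)))) = e (Submodule.Quotient.mk (ρ a y))
  rw [e.symm_apply_apply]
  rfl

end Intertwiners

section Model

variable {m : ℕ}

theorem add_add_add_self {M : Type*} [AddCommGroup M] [Module (ZMod 2) M] (a b c : M) :
    a + c + (b + c) = a + b := by
  rw [add_add_add_comm, ZModModule.add_self, add_zero]

theorem sumZeroRep_apply (σ : Equiv.Perm (Fin m)) (y : sumZero m) (x : Fin m) :
    (sumZeroRep m σ y).1 x = y.1 (σ⁻¹ x) := rfl

theorem mem_allOnesIn {y : sumZero m} : y ∈ allOnesIn m ↔ ∀ i j, y.1 i = y.1 j := by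
  constructor
  · intro hy i j
    obtain ⟨c, hc⟩ := Submodule.mem_span_singleton.1 hy
    rw [show y.1 = c • fun _ => 1 from hc.symm]
    rfl
  · intro h
    refine Submodule.mem_span_singleton.2 ?_
    rcases isEmpty_or_nonempty (Fin m) with _ | ⟨⟨i⟩⟩
    · exact ⟨0, Subsingleton.elim _ _⟩
    · exact ⟨y.1 i, funext fun j => (mul_one _).trans (h i j)⟩

/-- The vector `e_i + e_j` of `H`, which is zero if `i = j`. -/
def pairVec (i j : Fin m) : sumZero m :=
  ⟨Pi.single i 1 + Pi.single j 1, by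
    change ∑ x, _ = _
    simp only [Pi.add_apply, Finset.sum_add_distrib, Finset.sum_pi_single', Finset.mem_univ,
      if_true]
    exact CharTwo.add_self_eq_zero 1⟩

theorem pairVec_apply (i j x : Fin m) :
    (pairVec i j).1 x = (if x = i then 1 else 0) + if x = j then 1 else 0 := by
  simp [pairVec, Pi.single_apply]

theorem pairVec_self (i : Fin m) : pairVec i i = 0 :=
  Subtype.ext (ZModModule.add_self _)

theorem pairVec_add_pairVec (i j o : Fin m) : pairVec i o + pairVec j o = pairVec i j :=
  Subtype.ext (add_add_add_self _ _ _)

theorem sumZeroRep_swap (i j : Fin m) (y : sumZero m) :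
    sumZeroRep m (Equiv.swap i j) y = y + (y.1 i + y.1 j) • pairVec i j := by
  ext x
  change y.1 (Equiv.swap i j x) = y.1 x + (y.1 i + y.1 j) * (pairVec i j).1 x
  rw [pairVec_apply, Equiv.swap_apply_def]
  by_cases hi : x = i <;> by_cases hj : x = j <;>
    grind [CharTwo.add_self_eq_zero]

theorem sum_smul_pairVec (y : sumZero m) (p : Fin m) : ∑ x, y.1 x • pairVec x p = y := by
  have hy : ∑ x, y.1 x = 0 := y.2
  ext z
  simp [pairVec_apply, mul_add, Finset.sum_add_distrib, hy]

end Model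

section SymmetricType

variable {m : ℕ} {V : Type*} [AddCommGroup V] [Module (ZMod 2) V]
  {G : Subgroup (V ≃ₗ[ZMod 2] V)}

theorem isSymmetricOfDegree_iff :
    IsSymmetricOfDegree G m ↔ ∃ Φ : sumZero m →ₗ[ZMod 2] V, Function.Surjective Φ ∧
      LinearMap.ker Φ = allOnesIn m ∧
      ∀ g, g ∈ G ↔ ∃ σ, (g, σ) ∈ intertwiners (sumZeroRep m) Φ := by
  constructor
  · rintro ⟨e, he⟩
    refine ⟨e.symm.toLinearMap ∘ₗ (allOnesIn m).mkQ,
      e.symm.surjective.comp (Submodule.mkQ_surjective _), ?_, fun g => ?_⟩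
    · rw [LinearMap.ker_comp, LinearEquiv.ker, Submodule.comap_bot, Submodule.ker_mkQ]
    · rw [he]
      refine exists_congr fun σ => ?_
      rw [mem_intertwiners, (e.symm.surjective.forall.trans (Submodule.mkQ_surjective _).forall)]
      refine forall_congr' fun y => ?_
      rw [e.apply_symm_apply, ← LinearEquiv.eq_symm_apply]
      rfl
  · rintro ⟨Φ, hsurj, hker, hG⟩
    let e := (Submodule.quotEquivOfEq _ _ hker.symm).trans (Φ.quotKerEquivOfSurjective hsurj)
    refine ⟨e.symm, fun g => (hG g).trans (exists_congr fun σ => ?_)⟩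
    rw [mem_intertwiners, e.surjective.forall, (Submodule.mkQ_surjective _).forall]
    refine forall_congr' fun y => ?_
    rw [e.symm_apply_apply, LinearEquiv.symm_apply_eq]
    rfl

theorem isSymmetricOfDegree_of_swaps {Φ : sumZero m →ₗ[ZMod 2] V} (hsurj : Function.Surjective Φ)
    (hker : LinearMap.ker Φ = allOnesIn m)
    (hperm : G ≤ (intertwiners (sumZeroRep m) Φ).map (MonoidHom.fst _ _))
    (hswap : ∀ i j, ∃ g ∈ G, (g, Equiv.swap i j) ∈ intertwiners (sumZeroRep m) Φ) :
    IsSymmetricOfDegree G m := by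
  have hall : ⊤ ≤ (intertwiners (sumZeroRep m) Φ ⊓ G.prod ⊤).map (MonoidHom.snd _ _) := by
    refine Equiv.Perm.closure_isSwap.symm.trans_le ((Subgroup.closure_le _).2 ?_)
    rintro _ ⟨i, j, -, rfl⟩
    obtain ⟨g, hg, hgij⟩ := hswap i j
    exact ⟨(g, Equiv.swap i j), ⟨hgij, hg, trivial⟩, rfl⟩
  refine isSymmetricOfDegree_iff.2 ⟨Φ, hsurj, hker, fun g => ⟨fun hg => ?_, ?_⟩⟩
  · obtain ⟨⟨_, σ⟩, hσ, rfl⟩ := hperm hg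
    exact ⟨σ, hσ⟩
  · rintro ⟨σ, hσ⟩
    obtain ⟨⟨g', _⟩, ⟨hg'σ, hg', -⟩, rfl⟩ := hall (Subgroup.mem_top σ)
    rwa [eq_of_mem_intertwiners hsurj hσ hg'σ]

theorem IsSymmetricOfDegree.finrank_le (hG : IsSymmetricOfDegree G m) :
    Module.finrank (ZMod 2) V ≤ m := by
  obtain ⟨Φ, hsurj, -, -⟩ := isSymmetricOfDegree_iff.1 hG
  calc Module.finrank (ZMod 2) V ≤ Module.finrank (ZMod 2) (sumZero m) :=
        LinearMap.finrank_le_finrank_of_surjective hsurj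
    _ ≤ Module.finrank (ZMod 2) (Fin m → ZMod 2) := Submodule.finrank_le _
    _ = m := Module.finrank_fin_fun _

end SymmetricType

section LinearGroups

open scoped Pointwise

variable {K V : Type*} [Field K] [AddCommGroup V] [Module K V] {G : Subgroup (V ≃ₗ[K] V)}
  {W : Submodule K V}

theorem commutatorSpace_closure_le {T : Set (V ≃ₗ[K] V)} (hT : ∀ t ∈ T, ∀ v, t v - v ∈ W) :
    commutatorSpace (Subgroup.closure T) ≤ W := by
  refine Submodule.span_le.2 ?_
  rintro _ ⟨g, hg, v, rfl⟩
  induction hg using Subgroup.closure_induction generalizing v with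
  | mem g hg => exact hT g hg v
  | one => simp
  | mul g k _ _ ihg ihk =>
    rw [LinearEquiv.mul_apply, ← sub_add_sub_cancel (g (k v)) (k v) v]
    exact W.add_mem (ihg _) (ihk _)
  | inv g _ ih =>
    have := W.neg_mem (ih (g⁻¹ v))
    rwa [← LinearEquiv.mul_apply, mul_inv_cancel, neg_sub] at this

theorem le_stabilizer_iff : G ≤ MulAction.stabilizer (V ≃ₗ[K] V) (W : Set V) ↔
    ∀ g ∈ G, ∀ x ∈ W, g x ∈ W :=
  (MulAction.le_stabilizer_iff_smul_le _ _).trans (forall₂_congr fun _ _ => Set.image_subset_iff)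

theorem exists_mem_restrictTo (hG : G ≤ MulAction.stabilizer (V ≃ₗ[K] V) (W : Set V))
    {g : V ≃ₗ[K] V} (hg : g ∈ G) : ∃ h ∈ restrictTo G W, ∀ w : W, (h w : V) = g w := by
  refine ⟨g.ofSubmodules W W ?_, ⟨g, hg, fun w => rfl⟩, fun w => rfl⟩
  ext x
  rw [Submodule.mem_map_equiv]
  refine ⟨fun h => ?_, le_stabilizer_iff.1 hG _ (G.inv_mem hg) x⟩
  simpa using le_stabilizer_iff.1 hG g hg _ h

theorem isIrreducible_restrictTo_iff (hG : G ≤ MulAction.stabilizer (V ≃ₗ[K] V) (W : Set V)) :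
    (naturalRep (restrictTo G W)).IsIrreducible ↔ W ≠ ⊥ ∧ ∀ L ≤ W,
      G ≤ MulAction.stabilizer (V ≃ₗ[K] V) (L : Set V) → L = ⊥ ∨ L = W := by
  constructor
  · intro hirr
    refine ⟨?_, fun L hL hGL => ?_⟩
    · rintro rfl
      obtain ⟨ρ, ρ', hρ⟩ := hirr.exists_pair_ne
      exact hρ (Subrepresentation.toSubmodule_injective (Subsingleton.elim _ _))
    · let ρ : Subrepresentation (naturalRep (restrictTo G W)) :=
        ⟨L.comap W.subtype, fun ⟨h, g, hg, hgh⟩ v hv => by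
          change (h v : V) ∈ L
          rw [hgh]
          exact le_stabilizer_iff.1 hGL g hg _ hv⟩
      refine (hirr.eq_bot_or_eq_top ρ).imp (fun h => ?_) fun h => ?_
      · have h : L.comap W.subtype = ⊥ := congrArg Subrepresentation.toSubmodule h
        rw [← Submodule.map_comap_eq_of_le (p := L) (f := W.subtype) (by simpa using hL), h,
          Submodule.map_bot]
      · have h : L.comap W.subtype = ⊤ := congrArg Subrepresentation.toSubmodule h
        exact hL.antisymm (Submodule.comap_subtype_eq_top.1 h)
  · rintro ⟨hW, hL⟩
    have : Nontrivial W := Submodule.nontrivial_iff_ne_bot.2 hW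
    refine { exists_pair_ne := ⟨⊥, ⊤, fun h => ?_⟩, eq_bot_or_eq_top := fun ρ => ?_ }
    · exact bot_ne_top (congrArg Subrepresentation.toSubmodule h)
    · have hstable : G ≤ MulAction.stabilizer (V ≃ₗ[K] V)
          ((ρ.toSubmodule.map W.subtype : Submodule K V) : Set V) := by
        refine le_stabilizer_iff.2 fun g hg => ?_
        rintro _ ⟨w, hw, rfl⟩
        obtain ⟨h, hh, hhg⟩ := exists_mem_restrictTo hG hg
        exact ⟨h w, ρ.apply_mem_toSubmodule ⟨h, hh⟩ hw, hhg w⟩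
      refine (hL _ (Submodule.map_subtype_le _ _) hstable).imp (fun h => ?_) fun h => ?_
      · exact Subrepresentation.toSubmodule_injective
          (Submodule.map_injective_of_injective W.injective_subtype
            (h.trans (Submodule.map_bot _).symm))
      · exact Subrepresentation.toSubmodule_injective
          (Submodule.map_injective_of_injective W.injective_subtype
            (h.trans (Submodule.map_subtype_top W).symm))

end LinearGroups

section FormTransvections

open scoped Pointwise

variable {K V : Type*} [Field K] [AddCommGroup V] [Module K V] {f : LinearMap.BilinForm K V}

theorem mem_orthogonal_span_iff {B : Set V} {x : V} :
    x ∈ f.orthogonal (Submodule.span K B) ↔ ∀ u ∈ B, f u x = 0 :=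
  Submodule.span_le (p := LinearMap.ker (f.flip x))

theorem eq_zero_of_forall_form_eq_zero (hnd : f.Nondegenerate) {B : Set V}
    (hB : Submodule.span K B = ⊤) {x : V} (hx : ∀ u ∈ B, f u x = 0) : x = 0 := by
  have hmem := mem_orthogonal_span_iff.2 hx
  rwa [hB, LinearMap.BilinForm.orthogonal_top_eq_bot hnd] at hmem

theorem mem_orthogonal_iff_apply_eq_zero (hf : f.IsAlt) {W : Submodule K V} {x : V} :
    x ∈ f.orthogonal W ↔ ∀ w ∈ W, f x w = 0 :=
  forall₂_congr fun _ _ => hf.isRefl.eq_iff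

theorem span_eq_top_of_forall_exists_form_ne_zero [FiniteDimensional K V] (hf : f.IsAlt)
    (hnd : f.Nondegenerate) {S : Set V} (hS : ∀ r, r ≠ 0 → ∃ u ∈ S, f u r ≠ 0) :
    Submodule.span K S = ⊤ := by
  have hbot : f.orthogonal (Submodule.span K S) = ⊥ := by
    refine (Submodule.eq_bot_iff _).2 fun r hr => ?_
    by_contra hr0
    obtain ⟨u, hu, hur⟩ := hS r hr0
    exact hur (mem_orthogonal_span_iff.1 hr u hu)
  rw [← LinearMap.BilinForm.orthogonal_orthogonal hnd hf.isRefl (Submodule.span K S), hbot,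
    LinearMap.BilinForm.orthogonal_bot]

theorem restrict_isAlt (hf : f.IsAlt) (W : Submodule K V) : (f.restrict W).IsAlt :=
  fun x => hf x

/-- The group of isometries of the bilinear form `f`. -/
def isometrySubgroup (f : LinearMap.BilinForm K V) : Subgroup (V ≃ₗ[K] V) where
  carrier := {g | ∀ x y, f (g x) (g y) = f x y}
  one_mem' _ _ := rfl
  mul_mem' {g h} hg hh x y := (hg _ _).trans (hh x y)
  inv_mem' {g} hg x y := by
    rw [← hg, ← LinearEquiv.mul_apply, ← LinearEquiv.mul_apply, mul_inv_cancel]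
    rfl

/-- The transvection `x ↦ x + f(x, u) u` attached to the vector `u` and the alternating form `f`. -/
def formTransvection (hf : f.IsAlt) (u : V) : V ≃ₗ[K] V :=
  LinearEquiv.transvection (f := f.flip u) (v := u) (hf u)

theorem formTransvection_apply (hf : f.IsAlt) (u x : V) :
    formTransvection hf u x = x + f x u • u := rfl

theorem formTransvection_zero (hf : f.IsAlt) : formTransvection hf 0 = 1 := by
  ext x
  simp [formTransvection_apply]

theorem formTransvection_mem_isometrySubgroup (hf : f.IsAlt) (u : V) :
    formTransvection hf u ∈ isometrySubgroup f := fun x y => by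
  simp only [formTransvection_apply, map_add, map_smul, LinearMap.add_apply, LinearMap.smul_apply,
    smul_eq_mul, hf u, ← hf.neg_eq y u]
  ring

theorem formTransvection_apply_eq_conj (hf : f.IsAlt) {g : V ≃ₗ[K] V}
    (hg : g ∈ isometrySubgroup f) (u : V) :
    formTransvection hf (g u) = g * formTransvection hf u * g⁻¹ := by
  rw [eq_mul_inv_iff_mul_eq]
  ext x
  rw [LinearEquiv.mul_apply, LinearEquiv.mul_apply, formTransvection_apply, formTransvection_apply,
    hg x u, map_add, map_smul]

theorem formTransvection_mem_stabilizer (hf : f.IsAlt) {L : Submodule K V} {u : V}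
    (hu : u ∈ L ∨ ∀ x ∈ L, f x u = 0) :
    formTransvection hf u ∈ MulAction.stabilizer (V ≃ₗ[K] V) (L : Set V) := by
  refine MulAction.mem_stabilizer_set.2 fun x => ?_
  change x + f x u • u ∈ L ↔ x ∈ L
  rcases hu with hu | hu
  · exact L.add_mem_iff_left (L.smul_mem _ hu)
  · refine ⟨fun hx => ?_, fun hx => by rwa [hu x hx, zero_smul, add_zero]⟩
    have hxu : f x u = 0 := by simpa [hf u] using hu _ hx
    rwa [hxu, zero_smul, add_zero] at hx

/-- The group generated by the transvections attached to the vectors of `S`. -/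
def transvectionGroup (hf : f.IsAlt) (S : Set V) : Subgroup (V ≃ₗ[K] V) :=
  Subgroup.closure (formTransvection hf '' S)

theorem formTransvection_mem_transvectionGroup (hf : f.IsAlt) {S : Set V} {u : V} (hu : u ∈ S) :
    formTransvection hf u ∈ transvectionGroup hf S :=
  Subgroup.subset_closure ⟨u, hu, rfl⟩

theorem transvectionGroup_le_iff (hf : f.IsAlt) {S : Set V} {G : Subgroup (V ≃ₗ[K] V)} :
    transvectionGroup hf S ≤ G ↔ ∀ u ∈ S, formTransvection hf u ∈ G :=
  (Subgroup.closure_le _).trans Set.image_subset_iff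

theorem transvectionGroup_mono (hf : f.IsAlt) {S S' : Set V} (h : S ⊆ S') :
    transvectionGroup hf S ≤ transvectionGroup hf S' :=
  Subgroup.closure_mono (Set.image_mono h)

theorem transvectionGroup_le_isometrySubgroup (hf : f.IsAlt) (S : Set V) :
    transvectionGroup hf S ≤ isometrySubgroup f :=
  (transvectionGroup_le_iff hf).2 fun u _ => formTransvection_mem_isometrySubgroup hf u

theorem commutatorSpace_transvectionGroup (hf : f.IsAlt) (hnd : f.Nondegenerate) (B : Set V) :
    commutatorSpace (transvectionGroup hf B) = Submodule.span K B := by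
  apply le_antisymm
  · refine commutatorSpace_closure_le ?_
    rintro _ ⟨u, hu, rfl⟩ v
    rw [formTransvection_apply, add_sub_cancel_left]
    exact Submodule.smul_mem _ _ (Submodule.subset_span hu)
  · refine Submodule.span_le.2 fun u hu => ?_
    by_cases h0 : u = 0
    · exact h0 ▸ Submodule.zero_mem _
    · obtain ⟨x, hx⟩ := not_forall.1 (mt (hnd.2 u) h0)
      refine ((Submodule.smul_mem_iff _ hx).1 (Submodule.subset_span ⟨_,
        formTransvection_mem_transvectionGroup hf hu, x, ?_⟩))
      rw [formTransvection_apply, add_sub_cancel_left]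

section Restriction

variable {B : Set V} {W : Submodule K V}

theorem transvectionGroup_le_stabilizer (hf : f.IsAlt) (hB : B ⊆ W) :
    transvectionGroup hf B ≤ MulAction.stabilizer (V ≃ₗ[K] V) (W : Set V) :=
  (transvectionGroup_le_iff hf).2 fun _ hu => formTransvection_mem_stabilizer hf (.inl (hB hu))

theorem apply_eq_self_of_mem_orthogonal (hf : f.IsAlt) (hB : B ⊆ W) {g : V ≃ₗ[K] V}
    (hg : g ∈ transvectionGroup hf B) {x : V} (hx : x ∈ f.orthogonal W) : g x = x := by
  have hle : transvectionGroup hf B ≤ MulAction.stabilizer (V ≃ₗ[K] V) x := by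
    refine (transvectionGroup_le_iff hf).2 fun u hu => ?_
    change x + f x u • u = x
    rw [(mem_orthogonal_iff_apply_eq_zero hf).1 hx u (hB hu), zero_smul, add_zero]
  exact hle hg

theorem restrictTo_transvectionGroup (hf : f.IsAlt) (hB : B ⊆ W) :
    restrictTo (transvectionGroup hf B) W =
      transvectionGroup (restrict_isAlt hf W) (W.subtype ⁻¹' B) := by
  set H := transvectionGroup (restrict_isAlt hf W) (W.subtype ⁻¹' B)
  apply le_antisymm
  · have hle : transvectionGroup hf B ≤
        (intertwiners (naturalRep H) W.subtype).map (MonoidHom.fst _ _) :=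
      (transvectionGroup_le_iff hf).2 fun u hu =>
        ⟨(_, ⟨formTransvection (restrict_isAlt hf W) ⟨u, hB hu⟩,
          formTransvection_mem_transvectionGroup _ hu⟩), fun w => rfl, rfl⟩
    rintro h ⟨g, hg, hgh⟩
    obtain ⟨⟨_, k⟩, hk, rfl⟩ := hle hg
    have hkh : h = k := LinearEquiv.ext fun w => Subtype.ext ((hgh w).trans (hk w))
    exact hkh ▸ k.2
  · exact (transvectionGroup_le_iff _).2 fun u hu =>
      ⟨_, formTransvection_mem_transvectionGroup hf hu, fun w => rfl⟩

theorem formTransvection_mem_restrictTo_iff (hf : f.IsAlt) (hB : B ⊆ W)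
    (hW : Codisjoint W (f.orthogonal W)) (c : W) :
    formTransvection (restrict_isAlt hf W) c ∈ restrictTo (transvectionGroup hf B) W ↔
      formTransvection hf (c : V) ∈ transvectionGroup hf B := by
  refine ⟨fun ⟨g, hg, hgc⟩ => ?_, fun hc => ⟨_, hc, fun w => rfl⟩⟩
  suffices formTransvection hf (c : V) = g from this ▸ hg
  ext x
  obtain ⟨w, hw, z, hz, rfl⟩ := Submodule.mem_sup.1 (hW.eq_top.ge (Submodule.mem_top (x := x)))
  have hwc : formTransvection hf (c : V) w = g w := hgc ⟨w, hw⟩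
  rw [map_add, map_add, hwc, apply_eq_self_of_mem_orthogonal hf hB hg hz, formTransvection_apply,
    (mem_orthogonal_iff_apply_eq_zero hf).1 hz c c.2, zero_smul, add_zero]

theorem disjoint_orthogonal_of_isIrreducible (hf : f.IsAlt)
    (hirr : (naturalRep (restrictTo (transvectionGroup hf B) (Submodule.span K B))).IsIrreducible)
    (h2 : 2 ≤ Module.finrank K (Submodule.span K B)) :
    Disjoint (Submodule.span K B) (f.orthogonal (Submodule.span K B)) := by
  have hL := ((isIrreducible_restrictTo_iff
    (transvectionGroup_le_stabilizer hf Submodule.subset_span)).1 hirr).2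
  refine Submodule.disjoint_def.2 fun r hr hr' => ?_
  by_contra hr0
  have hstable : transvectionGroup hf B ≤
      MulAction.stabilizer (V ≃ₗ[K] V) (Submodule.span K {r} : Set V) := by
    refine (transvectionGroup_le_iff hf).2 fun u hu =>
      formTransvection_mem_stabilizer hf (.inr fun x hx => ?_)
    exact (mem_orthogonal_iff_apply_eq_zero hf).1
      (((Submodule.span_singleton_le_iff_mem r _).2 hr') hx) u (Submodule.subset_span hu)
  rcases hL _ ((Submodule.span_singleton_le_iff_mem r _).2 hr) hstable with h | h
  · exact hr0 (Submodule.span_singleton_eq_bot.1 h)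
  · rw [← h, finrank_span_singleton hr0] at h2
    lia

theorem two_le_finrank_of_disjoint_orthogonal [FiniteDimensional K W] (hf : f.IsAlt)
    (hdis : Disjoint W (f.orthogonal W)) (hne : W ≠ ⊥) : 2 ≤ Module.finrank K W := by
  have h0 : Module.finrank K W ≠ 0 := fun h => hne (Submodule.finrank_eq_zero.1 h)
  have h1 : Module.finrank K W ≠ 1 := by
    intro h
    obtain ⟨⟨u, hu⟩, hu0, hspan⟩ := finrank_eq_one_iff'.1 h
    refine hu0 (Subtype.ext (Submodule.disjoint_def.1 hdis u hu fun w hw => ?_))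
    obtain ⟨c, hc⟩ := hspan ⟨w, hw⟩
    have hc : c • u = w := congrArg Subtype.val hc
    change f w u = 0
    rw [← hc, map_smul, LinearMap.smul_apply, hf u, smul_zero]
  lia

end Restriction

end FormTransvections

section NonorthogonalityGraph

variable {K V : Type*} [Field K] [AddCommGroup V] [Module K V] {f : LinearMap.BilinForm K V}

/-- The graph on the vectors of `V` whose edges join non-orthogonal vectors; the group generated by
the transvections in `B` is irreducible on `span B` only if `B` induces a connected subgraph. -/
def nonorthogonalityGraph (hf : f.IsAlt) : SimpleGraph V where
  Adj x y := f x y ≠ 0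
  symm := ⟨fun _ _ => mt hf.isRefl.eq_iff.2⟩
  loopless := ⟨fun x hx => hx (hf x)⟩

theorem mem_of_preconnected {hf : f.IsAlt} {B : Set V}
    (hB : ((nonorthogonalityGraph hf).induce B).Preconnected) {P : Set V}
    (hP : ∀ u ∈ B, ∀ w ∈ B, u ∈ P → f u w ≠ 0 → w ∈ P) {u : V} (hu : u ∈ B) (huP : u ∈ P) :
    B ⊆ P := by
  suffices ∀ w : B, (w : V) ∈ P from fun w hw => this ⟨w, hw⟩
  intro w
  have huw := (SimpleGraph.reachable_iff_reflTransGen _ _).1 (hB ⟨u, hu⟩ w)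
  induction huw with
  | refl => exact huP
  | @tail x y _ hxy ih => exact hP x x.2 y y.2 ih hxy

theorem isIrreducible_of_preconnected (hf : f.IsAlt) {B : Set V}
    (hB : ((nonorthogonalityGraph hf).induce B).Preconnected)
    (hdis : Disjoint (Submodule.span K B) (f.orthogonal (Submodule.span K B)))
    (hne : Submodule.span K B ≠ ⊥) :
    (naturalRep (restrictTo (transvectionGroup hf B) (Submodule.span K B))).IsIrreducible := by
  refine (isIrreducible_restrictTo_iff
    (transvectionGroup_le_stabilizer hf Submodule.subset_span)).2 ⟨hne, fun L hL hstable => ?_⟩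
  have hmem : ∀ x ∈ L, ∀ u ∈ B, f x u ≠ 0 → u ∈ L := by
    intro x hx u hu hxu
    have := le_stabilizer_iff.1 hstable _ (formTransvection_mem_transvectionGroup hf hu) x hx
    rwa [formTransvection_apply, L.add_mem_iff_right hx, L.smul_mem_iff hxu] at this
  refine or_iff_not_imp_left.2 fun hL0 => hL.antisymm (Submodule.span_le.2 ?_)
  obtain ⟨w, hw, hw0⟩ := Submodule.exists_mem_ne_zero_of_ne_bot hL0
  obtain ⟨u, hu, hwu⟩ : ∃ u ∈ B, f w u ≠ 0 := by
    by_contra! h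
    exact hw0 (Submodule.disjoint_def.1 hdis w (hL hw)
      (mem_orthogonal_span_iff.2 fun u hu => hf.isRefl.eq_iff.1 (h u hu)))
  exact mem_of_preconnected hB (fun x _ y hy hx => hmem x hx y hy) hu (hmem w hw u hu hwu)

theorem finrank_radical_insert_lt (hf : f.IsAlt) {A : Set V}
    [FiniteDimensional K (Submodule.span K A)] {r u : V}
    (hr : r ∈ Submodule.span K A ⊓ f.orthogonal (Submodule.span K A)) (hur : f u r ≠ 0) :
    Module.finrank K (Submodule.span K (insert u A) ⊓
        f.orthogonal (Submodule.span K (insert u A)) : Submodule K V) <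
      Module.finrank K (Submodule.span K A ⊓ f.orthogonal (Submodule.span K A) :
        Submodule K V) := by
  refine Submodule.finrank_lt_finrank_of_lt (SetLike.lt_iff_le_and_exists.2 ⟨?_, r, hr, ?_⟩)
  · rintro x ⟨hx, hx'⟩
    have hle : Submodule.span K A ≤ Submodule.span K (insert u A) :=
      Submodule.span_mono (Set.subset_insert u A)
    refine ⟨?_, fun y hy => hx' y (hle hy)⟩
    obtain ⟨c, y, hy, rfl⟩ := Submodule.mem_span_insert.1 hx
    have hryx : f r (c • u + y) = 0 := hx' r (hle hr.1)
    rw [map_add, (mem_orthogonal_iff_apply_eq_zero hf).1 hr.2 y hy, add_zero, map_smul,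
      smul_eq_mul, mul_eq_zero, or_iff_left (mt hf.isRefl.eq_iff.1 hur)] at hryx
    rwa [hryx, zero_smul, zero_add]
  · exact fun h => hur (mem_orthogonal_span_iff.1 h.2 u (Set.mem_insert u A))

open Classical in
theorem exists_preconnected_disjoint_orthogonal (hf : f.IsAlt) {S : Set V}
    (hS : ∀ r, r ≠ 0 → ∃ u ∈ S, f u r ≠ 0) (d : ℕ) (A : Finset V) (hAS : ↑A ⊆ S)
    (hA : ((nonorthogonalityGraph hf).induce (A : Set V)).Preconnected)
    (hd : Module.finrank K (Submodule.span K (A : Set V) ⊓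
      f.orthogonal (Submodule.span K (A : Set V)) : Submodule K V) ≤ d) :
    ∃ B : Finset V, A ⊆ B ∧ ↑B ⊆ S ∧ B.card ≤ A.card + d ∧
      ((nonorthogonalityGraph hf).induce (B : Set V)).Preconnected ∧
      Disjoint (Submodule.span K (B : Set V)) (f.orthogonal (Submodule.span K (B : Set V))) := by
  induction d generalizing A with
  | zero =>
    exact ⟨A, subset_rfl, hAS, le_rfl, hA,
      disjoint_iff.2 (Submodule.finrank_eq_zero.1 (Nat.le_zero.1 hd))⟩
  | succ d ih =>
    by_cases hdis : Disjoint (Submodule.span K (A : Set V))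
        (f.orthogonal (Submodule.span K (A : Set V)))
    · exact ⟨A, subset_rfl, hAS, by lia, hA, hdis⟩
    obtain ⟨r, hr, hr0⟩ := Submodule.exists_mem_ne_zero_of_ne_bot (mt disjoint_iff.2 hdis)
    obtain ⟨u, huS, hur⟩ := hS r hr0
    obtain ⟨w, hwA, hwu⟩ : ∃ w ∈ A, f w u ≠ 0 := by
      by_contra! h
      exact hur ((mem_orthogonal_iff_apply_eq_zero hf).1 (mem_orthogonal_span_iff.2 h) r hr.1)
    have hpre : ((nonorthogonalityGraph hf).induce (insert u A : Set V)).Preconnected :=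
      (SimpleGraph.connected_induce_union (s := {u}) .of_subsingleton hA rfl hwA
        (mt hf.isRefl.eq_iff.1 hwu)).preconnected
    have hlt := finrank_radical_insert_lt hf hr hur
    rw [← Finset.coe_insert] at hpre hlt
    obtain ⟨B, hAB, hBS, hcard, hB⟩ := ih (insert u A)
      (by rw [Finset.coe_insert]; exact Set.insert_subset huS hAS) hpre (by lia)
    have := Finset.card_insert_le u A
    exact ⟨B, (Finset.subset_insert _ _).trans hAB, hBS, by lia, hB⟩

end NonorthogonalityGraph

section BinaryForms

variable {V : Type*} [AddCommGroup V] [Module (ZMod 2) V] {f : LinearMap.BilinForm (ZMod 2) V}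

theorem eq_one_of_ne_zero {a : ZMod 2} (ha : a ≠ 0) : a = 1 :=
  Fin.eq_one_of_ne_zero a ha

theorem form_comm (hf : f.IsAlt) (x y : V) : f x y = f y x := by
  rw [← hf.neg_eq, ZMod.neg_eq_self_mod_two]

theorem exists_form_eq_one (hnd : f.Nondegenerate) {u : V} (hu : u ≠ 0) : ∃ x, f x u = 1 := by
  obtain ⟨x, hx⟩ := not_forall.1 (mt (hnd.2 u) hu)
  exact ⟨x, eq_one_of_ne_zero hx⟩

theorem formTransvection_injective (hf : f.IsAlt) (hnd : f.Nondegenerate) :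
    Function.Injective (formTransvection hf) := by
  have heq : ∀ u w, formTransvection hf u = formTransvection hf w → u ≠ 0 → u = w := by
    intro u w h hu
    obtain ⟨x, hx⟩ := exists_form_eq_one hnd hu
    have hxw := LinearEquiv.congr_fun h x
    rw [formTransvection_apply, formTransvection_apply, hx, one_smul, add_right_inj] at hxw
    have : f x w ≠ 0 := fun h0 => hu (by rw [hxw, h0, zero_smul])
    rwa [eq_one_of_ne_zero this, one_smul] at hxw
  intro u w h
  by_cases hu : u = 0
  · by_contra hne
    exact hne (heq w u h.symm (hu ▸ Ne.symm hne)).symm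
  · exact heq u w h hu

theorem formTransvection_add_mem (hf : f.IsAlt) {G : Subgroup (V ≃ₗ[ZMod 2] V)} {a b : V}
    (ha : formTransvection hf a ∈ G) (hb : formTransvection hf b ∈ G) (hab : f a b = 1) :
    formTransvection hf (a + b) ∈ G := by
  have hconj := formTransvection_apply_eq_conj hf (formTransvection_mem_isometrySubgroup hf b) a
  rw [formTransvection_apply, hab, one_smul] at hconj
  exact hconj ▸ G.mul_mem (G.mul_mem hb ha) (G.inv_mem hb)

theorem exists_eq_formTransvection (hf : f.IsAlt) (hnd : f.Nondegenerate) {t : V ≃ₗ[ZMod 2] V}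
    (ht : IsTransvection t) (htf : t ∈ isometrySubgroup f) : ∃ u, t = formTransvection hf u := by
  obtain ⟨⟨u, _⟩, hu0, hspan⟩ := finrank_eq_one_iff'.1 ht.2
  have hu : u ≠ 0 := fun h => hu0 (Subtype.ext h)
  have hex : ∀ x, ∃ c : ZMod 2, t x = x + c • u := fun x => by
    obtain ⟨c, hc⟩ := hspan ⟨_, LinearMap.mem_range_self _ x⟩
    have hc : c • u = t x - x := congrArg Subtype.val hc
    exact ⟨c, by rw [hc, add_sub_cancel]⟩
  choose ψ hψ using hex
  obtain ⟨y, hy⟩ := exists_form_eq_one hnd hu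
  have hrel : ∀ x, ψ x = ψ y * f x u := fun x => by
    have h := htf x y
    simp only [hψ, map_add, map_smul, LinearMap.add_apply, LinearMap.smul_apply, smul_eq_mul,
      hf u, mul_zero, add_zero, form_comm hf u y, hy, mul_one] at h
    rwa [add_assoc, add_eq_left, add_comm, CharTwo.add_eq_zero, eq_comm] at h
  rcases eq_or_ne (ψ y) 0 with h0 | h0
  · refine ⟨0, LinearEquiv.ext fun x => ?_⟩
    rw [hψ, hrel, h0, zero_mul, zero_smul, formTransvection_zero, LinearEquiv.coe_one, id, add_zero]
  · refine ⟨u, LinearEquiv.ext fun x => ?_⟩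
    rw [hψ, hrel, eq_one_of_ne_zero h0, one_mul, formTransvection_apply]

theorem exists_mem_form_eq_one_of_isDenseSet (hf : f.IsAlt) (hnd : f.Nondegenerate) {S : Set V}
    (hdense : IsDenseSet (formTransvection hf '' S)) {v w : V} (hv : v ≠ 0) (hw : w ≠ 0) :
    ∃ u ∈ S, f u v = 1 ∧ f u w = 1 := by
  obtain ⟨y, hy⟩ := exists_form_eq_one hnd hw
  have hφ : f.flip w ≠ 0 := fun h => one_ne_zero (hy.symm.trans (LinearMap.congr_fun h y))
  obtain ⟨_, ⟨u, huS, rfl⟩, u', ψ, ht, hu'w, hψv⟩ := hdense v hv (f.flip w) hφ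
  have hu' : u' ≠ 0 := fun h => hu'w (by rw [h, map_zero])
  have hu'u : f v u • u = u' := by
    have h := ht v
    rwa [formTransvection_apply, add_right_inj, eq_one_of_ne_zero hψv, one_smul] at h
  have hvu : f v u = 1 := eq_one_of_ne_zero fun h => hu' (by rw [← hu'u, h, zero_smul])
  rw [hvu, one_smul] at hu'u
  exact ⟨u, huS, (form_comm hf u v).trans hvu, eq_one_of_ne_zero (hu'u ▸ hu'w)⟩

end BinaryForms

section Simplices

variable {V ι κ : Type*} [AddCommGroup V] {q : ι → V}

/-- The edge vectors `q i + q j` of a family of points, including `0 = q i + q i`. -/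
def edges (q : ι → V) : Set V := {c | ∃ i j, c = q i + q j}

theorem mem_edges (i j : ι) : q i + q j ∈ edges q := ⟨i, j, rfl⟩

theorem edges_comp_equiv (e : κ ≃ ι) : edges (q ∘ e) = edges q := by
  ext c
  simp [edges, e.surjective.exists]

variable [Module (ZMod 2) V] {f : LinearMap.BilinForm (ZMod 2) V}

/-- A family of points is a simplex if any two distinct edges with a common endpoint are
non-orthogonal. The transvections attached to its edges then act as the transpositions of `ι`. Only
the differences of the points matter. -/
def IsSimplex (f : LinearMap.BilinForm (ZMod 2) V) (q : ι → V) : Prop :=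
  ∀ i j o, i ≠ j → i ≠ o → j ≠ o → f (q i + q o) (q j + q o) = 1

theorem IsSimplex.comp_injective (hq : IsSimplex f q) {e : κ → ι} (he : Function.Injective e) :
    IsSimplex f (q ∘ e) :=
  fun _ _ _ hij hio hjo => hq _ _ _ (he.ne hij) (he.ne hio) (he.ne hjo)

theorem IsSimplex.form_edge_edge_common [DecidableEq ι] (hf : f.IsAlt) (hq : IsSimplex f q)
    (i k l : ι) :
    f (q i + q l) (q k + q l) =
      (if i = k then 1 else 0) + (if i = l then 1 else 0) + (if l = k then 1 else 0) + 1 := by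
  rcases eq_or_ne i l with rfl | hil
  · rw [ZModModule.add_self, map_zero, LinearMap.zero_apply]
    grind [CharTwo.add_self_eq_zero]
  rcases eq_or_ne l k with rfl | hlk
  · simp [hil, ZModModule.add_self]
  rcases eq_or_ne i k with rfl | hik
  · rw [hf]
    simp [hil, hlk, CharTwo.add_self_eq_zero]
  · simp [-map_add, hil, hlk, hik, hq i k l hik hil hlk.symm]

theorem IsSimplex.form_edge_edge [DecidableEq ι] (hf : f.IsAlt) (hq : IsSimplex f q)
    (i j k l : ι) :
    f (q i + q j) (q k + q l) =
      (if i = k then 1 else 0) + (if i = l then 1 else 0) + (if j = k then 1 else 0) +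
        (if j = l then 1 else 0) := by
  rw [← add_add_add_self (q i) (q j) (q l), LinearMap.BilinForm.add_left,
    hq.form_edge_edge_common hf, hq.form_edge_edge_common hf]
  grind [CharTwo.add_self_eq_zero]

theorem isSimplex_of_base (hf : f.IsAlt) (o : ι)
    (h : ∀ i j, i ≠ o → j ≠ o → i ≠ j → f (q i + q o) (q j + q o) = 1) : IsSimplex f q := by
  intro i j p hij hip hjp
  rw [← add_add_add_self (q i) (q p) (q o), ← add_add_add_self (q j) (q p) (q o)]
  obtain ⟨b, hb⟩ : ∃ b : ι → V, ∀ x, q x + q o = b x := ⟨_, fun _ => rfl⟩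
  have hbo : b o = 0 := by rw [← hb, ZModModule.add_self]
  simp only [hb] at h ⊢
  rcases eq_or_ne p o with rfl | hpo
  · rw [hbo, add_zero, add_zero]
    exact h i j hip hjp hij
  have hself : f (b p) (b p) = 0 := hf _
  rcases eq_or_ne i o with rfl | hio
  · simp [hbo, hself, h p j hpo hij.symm hjp.symm]
  rcases eq_or_ne j o with rfl | hjo
  · simp [hbo, hself, h i p hio hpo hip]
  · simp [hself, h i j hio hjo hij, h i p hio hpo hip, h p j hpo hjo hjp.symm,
      CharTwo.add_self_eq_zero]

theorem IsSimplex.formTransvection_mem_of_base (hf : f.IsAlt) (hq : IsSimplex f q)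
    {G : Subgroup (V ≃ₗ[ZMod 2] V)} {o : ι} (hG : ∀ i, formTransvection hf (q i + q o) ∈ G) {c : V}
    (hc : c ∈ edges q) : formTransvection hf c ∈ G := by
  obtain ⟨i, j, rfl⟩ := hc
  rcases eq_or_ne i j with rfl | hij
  · rw [ZModModule.add_self, formTransvection_zero]
    exact G.one_mem
  rcases eq_or_ne j o with rfl | hjo
  · exact hG i
  rcases eq_or_ne i o with rfl | hio
  · exact add_comm (q j) (q i) ▸ hG j
  · rw [← add_add_add_self (q i) (q j) (q o)]
    exact formTransvection_add_mem hf (hG i) (hG j) (hq i j o hij hio hjo)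

end Simplices

section SimplexModel

variable {V : Type*} [AddCommGroup V] [Module (ZMod 2) V] {f : LinearMap.BilinForm (ZMod 2) V}
  {m : ℕ} {q : Fin m → V}

/-- The linear map `H → V` sending `e_i + e_j` to the edge `q i + q j`. -/
def edgeMap (q : Fin m → V) : sumZero m →ₗ[ZMod 2] V :=
  Fintype.linearCombination (ZMod 2) q ∘ₗ (sumZero m).subtype

theorem edgeMap_pairVec (i j : Fin m) : edgeMap q (pairVec i j) = q i + q j := by
  simp [edgeMap, pairVec]

theorem edgeMap_eq_sum (y : sumZero m) (p : Fin m) :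
    edgeMap q y = ∑ x, y.1 x • (q x + q p) := by
  simp only [← edgeMap_pairVec, ← map_smul, ← map_sum, sum_smul_pairVec]

theorem range_edgeMap : LinearMap.range (edgeMap q) = Submodule.span (ZMod 2) (edges q) := by
  apply le_antisymm
  · rintro _ ⟨y, rfl⟩
    rcases isEmpty_or_nonempty (Fin m) with _ | ⟨⟨p⟩⟩
    · simp [edgeMap, Fintype.linearCombination_apply]
    · rw [edgeMap_eq_sum y p]
      exact Submodule.sum_smul_mem _ _ fun x _ => Submodule.subset_span (mem_edges x p)
  · refine Submodule.span_le.2 ?_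
    rintro _ ⟨i, j, rfl⟩
    exact ⟨pairVec i j, edgeMap_pairVec i j⟩

theorem IsSimplex.form_edgeMap (hf : f.IsAlt) (hq : IsSimplex f q) (y : sumZero m) (i j : Fin m) :
    f (edgeMap q y) (q i + q j) = y.1 i + y.1 j := by
  have hy : ∑ x, y.1 x = 0 := y.2
  rw [edgeMap_eq_sum y i, map_sum, LinearMap.sum_apply]
  simp only [map_smul, LinearMap.smul_apply, smul_eq_mul, hq.form_edge_edge hf, mul_add,
    Finset.sum_add_distrib, ← Finset.sum_mul, hy]
  simp

theorem IsSimplex.formTransvection_mem_intertwiners (hf : f.IsAlt) (hq : IsSimplex f q)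
    (i j : Fin m) : (formTransvection hf (q i + q j), Equiv.swap i j) ∈
      intertwiners (sumZeroRep m) (edgeMap q) := fun y => by
  rw [sumZeroRep_swap, map_add, map_smul, edgeMap_pairVec, formTransvection_apply,
    hq.form_edgeMap hf]

theorem IsSimplex.ker_edgeMap (hf : f.IsAlt) (hnd : f.Nondegenerate) (hq : IsSimplex f q)
    (hspan : Submodule.span (ZMod 2) (edges q) = ⊤) :
    LinearMap.ker (edgeMap q) = allOnesIn m := by
  ext y
  rw [LinearMap.mem_ker, mem_allOnesIn]
  have hiff : edgeMap q y = 0 ↔ ∀ c ∈ edges q, f (edgeMap q y) c = 0 := by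
    refine ⟨fun h c _ => by rw [h, map_zero, LinearMap.zero_apply], fun h => ?_⟩
    exact eq_zero_of_forall_form_eq_zero hnd hspan fun c hc => hf.isRefl.eq_iff.1 (h c hc)
  rw [hiff]
  constructor
  · intro h i j
    rw [← CharTwo.add_eq_zero, ← hq.form_edgeMap hf]
    exact h _ (mem_edges i j)
  · rintro h _ ⟨i, j, rfl⟩
    rw [hq.form_edgeMap hf, h i j, CharTwo.add_self_eq_zero]

theorem IsSimplex.isSymmetricOfDegree {ι : Type*} [Finite ι] {q : ι → V} {S : Set V}
    (hf : f.IsAlt) (hnd : f.Nondegenerate) (hq : IsSimplex f q)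
    (hspan : Submodule.span (ZMod 2) (edges q) = ⊤) (hS : S ⊆ edges q)
    (hG : ∀ c ∈ edges q, formTransvection hf c ∈ transvectionGroup hf S) :
    IsSymmetricOfDegree (transvectionGroup hf S) (Nat.card ι) := by
  let e : Fin (Nat.card ι) ≃ ι := (Finite.equivFin ι).symm
  have hqe := hq.comp_injective e.injective
  rw [← edges_comp_equiv e] at hspan hS hG
  refine isSymmetricOfDegree_of_swaps
    (LinearMap.range_eq_top.1 (range_edgeMap.trans hspan)) (hqe.ker_edgeMap hf hnd hspan) ?_
    fun i j => ⟨_, hG _ (mem_edges i j), hqe.formTransvection_mem_intertwiners hf i j⟩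
  refine (transvectionGroup_le_iff hf).2 fun u hu => ?_
  obtain ⟨i, j, rfl⟩ := hS hu
  exact ⟨_, hqe.formTransvection_mem_intertwiners hf i j, rfl⟩

end SimplexModel

section SimplexOfSymmetric

variable {V : Type*} [AddCommGroup V] [Module (ZMod 2) V] {f : LinearMap.BilinForm (ZMod 2) V}
  {m : ℕ}

theorem exists_fin_notMem {s : Finset (Fin m)} (hs : s.card < m) : ∃ k, k ∉ s := by
  obtain ⟨k, -, hk⟩ := Finset.exists_mem_notMem_of_card_lt_card (t := Finset.univ)
    (hs.trans_eq (Finset.card_fin m).symm)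
  exact ⟨k, hk⟩

theorem form_pairVec_of_isometry (hf : f.IsAlt) (hnd : f.Nondegenerate)
    {Φ : sumZero m →ₗ[ZMod 2] V} (hsurj : Function.Surjective Φ)
    (hker : LinearMap.ker Φ = allOnesIn m)
    (hΦ : ∀ g σ, (g, σ) ∈ intertwiners (sumZeroRep m) Φ → g ∈ isometrySubgroup f) (hm : 3 ≤ m)
    (y : sumZero m) (i j : Fin m) : f (Φ y) (Φ (pairVec i j)) = y.1 i + y.1 j := by
  rcases eq_or_ne i j with rfl | hij
  · rw [pairVec_self, map_zero, map_zero, CharTwo.add_self_eq_zero]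
  set u := Φ (pairVec i j)
  obtain ⟨k, hk⟩ := exists_fin_notMem (s := {i, j}) (Finset.card_le_two.trans_lt hm)
  simp only [Finset.mem_insert, Finset.mem_singleton, not_or] at hk
  have hu : u ≠ 0 := fun h => by
    have := mem_allOnesIn.1 (hker ▸ LinearMap.mem_ker.2 h) i k
    simp [pairVec_apply, hij, hk.1, hk.2] at this
  obtain ⟨g, hg⟩ := exists_mem_intertwiners (ρ := sumZeroRep m) hsurj
    (hker ▸ allOnesIn_le_comap m) (Equiv.swap i j)
  have hgu (y : sumZero m) : g (Φ y) = Φ y + (y.1 i + y.1 j) • u := by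
    rw [mem_intertwiners.1 hg, sumZeroRep_swap, map_add, map_smul]
  have hsymm (y w : sumZero m) :
      (w.1 i + w.1 j) * f (Φ y) u = (y.1 i + y.1 j) * f (Φ w) u := by
    have h := hΦ g _ hg (Φ y) (Φ w)
    simp only [hgu, map_add, map_smul, LinearMap.add_apply, LinearMap.smul_apply, smul_eq_mul,
      hf u, mul_zero, add_zero, form_comm hf u] at h
    rwa [add_assoc, add_eq_left, CharTwo.add_eq_zero, eq_comm] at h
  obtain ⟨x, hx⟩ := exists_form_eq_one hnd hu
  obtain ⟨z, rfl⟩ := hsurj x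
  have hz (w : sumZero m) : w.1 i + w.1 j = (z.1 i + z.1 j) * f (Φ w) u := by
    rw [← hsymm, hx, mul_one]
  have hz1 : z.1 i + z.1 j = 1 := eq_one_of_ne_zero fun h => by
    have := hz (pairVec i k)
    simp [h, pairVec_apply, hij.symm, Ne.symm hk.1, Ne.symm hk.2] at this
  rw [hz y, hz1, one_mul]

theorem exists_isSimplex_edgeMap_eq {Φ : sumZero m →ₗ[ZMod 2] V} (o : Fin m)
    (hΦ : ∀ y i j, f (Φ y) (Φ (pairVec i j)) = y.1 i + y.1 j) :
    ∃ q : Fin m → V, IsSimplex f q ∧ edgeMap q = Φ := by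
  refine ⟨fun i => Φ (pairVec i o), fun i j k hij hik hjk => ?_, LinearMap.ext fun y => ?_⟩
  · rw [← map_add, ← map_add, pairVec_add_pairVec, pairVec_add_pairVec, hΦ]
    simp [pairVec_apply, hij.symm, hik.symm, hjk]
  · rw [← sum_smul_pairVec y o]
    simp [edgeMap_pairVec, pairVec_self]

variable {q : Fin m → V} {c : V} {σ : Equiv.Perm (Fin m)}

theorem sumZeroRep_pairVec (σ : Equiv.Perm (Fin m)) (i j : Fin m) :
    sumZeroRep m σ (pairVec i j) = pairVec (σ i) (σ j) := by
  ext x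
  simp only [sumZeroRep_apply, pairVec_apply, Equiv.Perm.inv_eq_iff_eq]

theorem add_add_of_formTransvection_mem_intertwiners (hf : f.IsAlt)
    (hσ : (formTransvection hf c, σ) ∈ intertwiners (sumZeroRep m) (edgeMap q)) (i j : Fin m) :
    q i + q (σ i) + (q j + q (σ j)) = f (q i + q j) c • c := by
  have h := mem_intertwiners.1 hσ (pairVec i j)
  rw [sumZeroRep_pairVec, edgeMap_pairVec, edgeMap_pairVec, formTransvection_apply] at h
  rw [add_add_add_comm, ← h, ← add_assoc, ZModModule.add_self, zero_add]

theorem mem_edges_of_odd (hf : f.IsAlt) (hm : Odd m)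
    (hσ : (formTransvection hf c, σ) ∈ intertwiners (sumZeroRep m) (edgeMap q)) {i j : Fin m}
    (hij : f (q i + q j) c = 1) : c ∈ edges q := by
  have hD (o : Fin m) : q o + q (σ o) = (∑ x, f (q x + q o) c) • c := by
    calc q o + q (σ o) = ∑ x, (q x + q (σ x)) + ∑ _x : Fin m, (q o + q (σ o)) := by
          rw [Finset.sum_add_distrib, Equiv.sum_comp σ q, ZModModule.add_self, zero_add,
            Finset.sum_const, Finset.card_fin, ← Nat.cast_smul_eq_nsmul (ZMod 2),
            ZMod.natCast_eq_one_iff_odd.2 hm, one_smul]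
      _ = (∑ x, f (q x + q o) c) • c := by
          rw [← Finset.sum_add_distrib, Finset.sum_smul]
          exact Finset.sum_congr rfl fun x _ =>
            add_add_of_formTransvection_mem_intertwiners hf hσ x o
  by_contra hc
  have hD0 (o : Fin m) : q o + q (σ o) = 0 := by
    by_contra h0
    have h1 := hD o
    have hne : ∑ x, f (q x + q o) c ≠ 0 := fun h => h0 (by rw [h1, h, zero_smul])
    rw [eq_one_of_ne_zero hne, one_smul] at h1
    exact hc (h1 ▸ mem_edges o (σ o))
  have h := add_add_of_formTransvection_mem_intertwiners hf hσ i j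
  rw [hD0, hD0, hij, one_smul, add_zero] at h
  exact hc ⟨i, i, by rw [← h, ZModModule.add_self]⟩

theorem mem_edges_of_five_le (hf : f.IsAlt) (hq : IsSimplex f q) (hm : 5 ≤ m)
    (hσ : (formTransvection hf c, σ) ∈ intertwiners (sumZeroRep m) (edgeMap q)) {i j : Fin m}
    (hij : f (q i + q j) c = 1) : c ∈ edges q := by
  by_contra hc
  have hcij := add_add_of_formTransvection_mem_intertwiners hf hσ i j
  rw [hij, one_smul] at hcij
  have hne : ∀ a b, c ≠ q a + q b := fun a b h => hc ⟨a, b, h⟩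
  have hi : σ i ≠ i := fun h => hne j (σ j) (by rw [← hcij, h, ZModModule.add_self, zero_add])
  have hj : σ j ≠ j := fun h => hne i (σ i) (by rw [← hcij, h, ZModModule.add_self, add_zero])
  have hji : j ≠ i := fun h => zero_ne_one <| by
    rw [← hij, h, ZModModule.add_self, map_zero, LinearMap.zero_apply]
  have hσji : σ j ≠ i := fun h => hne (σ i) j (by
    rw [← hcij, h, add_comm (q i), add_add_add_self])
  obtain ⟨l, hl⟩ := exists_fin_notMem (s := {i, σ i, j, σ j}) (Finset.card_le_four.trans_lt hm)
  obtain ⟨w, hw⟩ := exists_fin_notMem (s := {j, σ j, l, σ l}) (Finset.card_le_four.trans_lt hm)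
  simp only [Finset.mem_insert, Finset.mem_singleton, not_or] at hl hw
  have hli : f (q l + q i) c = 1 := by
    rw [← hcij, LinearMap.BilinForm.add_right, hq.form_edge_edge hf, hq.form_edge_edge hf]
    simp [hl, hi.symm, hji.symm, hσji.symm]
  have hDl : q l + q (σ l) = q j + q (σ j) := by
    have hli' := add_add_of_formTransvection_mem_intertwiners hf hσ l i
    rw [hli, one_smul, ← hcij, add_comm (q i + q (σ i))] at hli'
    exact add_right_cancel hli'
  have htest := congrArg (f (q (σ j) + q w)) hDl
  rw [hq.form_edge_edge hf, hq.form_edge_edge hf] at htest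
  simp [hw, hj, Ne.symm hl.2.2.2, Ne.symm hl.2.2.1] at htest

theorem exists_isSimplex_of_isSymmetricOfDegree [Nontrivial V] (hf : f.IsAlt)
    (hnd : f.Nondegenerate) {G : Subgroup (V ≃ₗ[ZMod 2] V)} (hGf : G ≤ isometrySubgroup f)
    (hG : IsSymmetricOfDegree G m) (hm : Odd m ∨ 5 ≤ m) :
    ∃ q : Fin m → V, IsSimplex f q ∧ Submodule.span (ZMod 2) (edges q) = ⊤ ∧
      ∀ c, formTransvection hf c ∈ G ↔ c ∈ edges q := by
  obtain ⟨Φ, hsurj, hker, hG⟩ := isSymmetricOfDegree_iff.1 hG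
  have hm1 : m ≠ 1 := by
    rintro rfl
    obtain ⟨v, hv⟩ := exists_ne (0 : V)
    obtain ⟨y, rfl⟩ := hsurj v
    exact hv (LinearMap.mem_ker.1 (hker ▸ mem_allOnesIn.2 fun i j => by rw [Subsingleton.elim i j]))
  have hm3 : 3 ≤ m := by rcases hm with ⟨k, rfl⟩ | hm <;> lia
  obtain ⟨q, hq, rfl⟩ := exists_isSimplex_edgeMap_eq ⟨0, by lia⟩
    (form_pairVec_of_isometry hf hnd hsurj hker (fun g σ h => hGf ((hG g).2 ⟨σ, h⟩)) hm3)
  have hspan : Submodule.span (ZMod 2) (edges q) = ⊤ :=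
    range_edgeMap.symm.trans (LinearMap.range_eq_top.2 hsurj)
  refine ⟨q, hq, hspan, fun c => ⟨fun hc => ?_, ?_⟩⟩
  · obtain ⟨σ, hσ⟩ := (hG _).1 hc
    by_contra hce
    have hc0 : c ≠ 0 := fun h =>
      hce (h ▸ ⟨⟨0, by lia⟩, ⟨0, by lia⟩, (ZModModule.add_self _).symm⟩)
    obtain ⟨i, j, hij⟩ : ∃ i j, f (q i + q j) c = 1 := by
      by_contra! h
      refine hc0 (eq_zero_of_forall_form_eq_zero hnd hspan ?_)
      rintro _ ⟨i, j, rfl⟩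
      exact of_not_not (mt eq_one_of_ne_zero (h i j))
    exact hce (hm.elim (mem_edges_of_odd hf · hσ hij) (mem_edges_of_five_le hf hq · hσ hij))
  · rintro ⟨i, j, rfl⟩
    exact (hG _).2 ⟨_, hq.formTransvection_mem_intertwiners hf i j⟩

end SimplexOfSymmetric

section VertexBlocks

open scoped Pointwise

variable {V ι : Type*} [AddCommGroup V] [Module (ZMod 2) V] {f : LinearMap.BilinForm (ZMod 2) V}
  {q : ι → V} {B : Set V}

theorem mem_span_of_formTransvection_mem (hf : f.IsAlt) (hnd : f.Nondegenerate) {c : V}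
    (hc : formTransvection hf c ∈ transvectionGroup hf B) : c ∈ Submodule.span (ZMod 2) B := by
  rcases eq_or_ne c 0 with rfl | hc0
  · exact Submodule.zero_mem _
  obtain ⟨x, hx⟩ := exists_form_eq_one hnd hc0
  rw [← commutatorSpace_transvectionGroup hf hnd]
  exact Submodule.subset_span
    ⟨_, hc, x, by rw [formTransvection_apply, hx, one_smul, add_sub_cancel_left]⟩

theorem IsSimplex.isSymmetricOfDegree_restrictTo [Finite ι] [Nonempty ι] (hf : f.IsAlt)
    (hnd : f.Nondegenerate) (hq : IsSimplex f q) (hB : B ⊆ edges q)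
    (hG : ∀ c ∈ edges q, formTransvection hf c ∈ transvectionGroup hf B)
    (hdis : Disjoint (Submodule.span (ZMod 2) B) (f.orthogonal (Submodule.span (ZMod 2) B))) :
    IsSymmetricOfDegree
      (restrictTo (transvectionGroup hf B) (Submodule.span (ZMod 2) B)) (Nat.card ι) := by
  set W := Submodule.span (ZMod 2) B
  obtain ⟨o⟩ := ‹Nonempty ι›
  let q' : ι → W := fun i => ⟨q i + q o, mem_span_of_formTransvection_mem hf hnd (hG _ ⟨i, o, rfl⟩)⟩
  have hcoe (i j : ι) : (q' i + q' j : V) = q i + q j := add_add_add_self _ _ _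
  have hedges : ∀ c : W, (c : V) ∈ edges q → c ∈ edges q' := by
    rintro c ⟨i, j, hc⟩
    exact ⟨i, j, Subtype.ext (hc.trans (hcoe i j).symm)⟩
  have hsub : W.subtype ⁻¹' B ⊆ edges q' := fun c hc => hedges c (hB hc)
  rw [restrictTo_transvectionGroup hf Submodule.subset_span]
  refine IsSimplex.isSymmetricOfDegree (restrict_isAlt hf W)
    (LinearMap.BilinForm.nondegenerate_restrict_of_disjoint_orthogonal f hf.isRefl hdis)
    (q := q') (fun i j k hij hik hjk => ?_) ?_ hsub ?_
  · change f (q' i + q' k : V) (q' j + q' k : V) = 1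
    rw [hcoe, hcoe, hq i j k hij hik hjk]
  · exact top_unique (Submodule.span_span_coe_preimage.ge.trans (Submodule.span_mono hsub))
  · rintro _ ⟨i, j, rfl⟩
    rw [← restrictTo_transvectionGroup hf Submodule.subset_span]
    exact ⟨_, hG _ ⟨i, j, hcoe i j⟩, fun w => rfl⟩

/-- The vertices joined to `p` by an edge whose transvection lies in `G`; this is the orbit of `p`
when `G` acts as a group generated by transpositions of the vertices. -/
def vertexBlock (hf : f.IsAlt) (q : ι → V) (G : Subgroup (V ≃ₗ[ZMod 2] V)) (p : ι) : Set ι :=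
  {i | formTransvection hf (q i + q p) ∈ G}

theorem self_mem_vertexBlock (hf : f.IsAlt) (G : Subgroup (V ≃ₗ[ZMod 2] V)) (p : ι) :
    p ∈ vertexBlock hf q G p := by
  change formTransvection hf (q p + q p) ∈ G
  rw [ZModModule.add_self, formTransvection_zero]
  exact G.one_mem

theorem IsSimplex.mem_vertexBlock (hf : f.IsAlt) (hq : IsSimplex f q)
    {G : Subgroup (V ≃ₗ[ZMod 2] V)} {a b p : ι} (hab : formTransvection hf (q a + q b) ∈ G)
    (ha : a ∈ vertexBlock hf q G p) : b ∈ vertexBlock hf q G p := by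
  rcases eq_or_ne b p with rfl | hbp
  · exact self_mem_vertexBlock hf G b
  rcases eq_or_ne a b with rfl | hab'
  · exact ha
  rw [add_comm] at hab
  rcases eq_or_ne a p with rfl | hap
  · exact hab
  · change formTransvection hf (q b + q p) ∈ G
    have ha : formTransvection hf (q a + q p) ∈ G := ha
    rw [add_comm] at ha
    rw [← add_add_add_self (q b) (q p) (q a)]
    exact formTransvection_add_mem hf hab ha (hq b p a hbp hab'.symm hap.symm)

theorem IsSimplex.formTransvection_mem_of_mem_edges_vertexBlock (hf : f.IsAlt) (hq : IsSimplex f q)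
    {G : Subgroup (V ≃ₗ[ZMod 2] V)} {p : ι} {c : V}
    (hc : c ∈ edges fun i : vertexBlock hf q G p => q i) : formTransvection hf c ∈ G :=
  (hq.comp_injective Subtype.val_injective).formTransvection_mem_of_base hf
    (o := ⟨p, self_mem_vertexBlock hf G p⟩) (fun i => i.2) hc

theorem IsSimplex.form_eq_zero_of_notMem (hf : f.IsAlt) (hq : IsSimplex f q) {C : Set ι} {a b : ι}
    (ha : a ∉ C) (hb : b ∉ C) {x : V}
    (hx : x ∈ Submodule.span (ZMod 2) (edges fun i : C => q i)) : f x (q a + q b) = 0 := by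
  classical
  have hmem : q a + q b ∈ f.orthogonal (Submodule.span (ZMod 2) (edges fun i : C => q i)) := by
    refine mem_orthogonal_span_iff.2 ?_
    rintro _ ⟨i, j, rfl⟩
    rw [hq.form_edge_edge hf]
    simp [ne_of_mem_of_not_mem i.2 ha, ne_of_mem_of_not_mem i.2 hb,
      ne_of_mem_of_not_mem j.2 ha, ne_of_mem_of_not_mem j.2 hb]
  exact hmem x hx

theorem IsSimplex.mem_edges_vertexBlock_or_form_eq_zero (hf : f.IsAlt) (hq : IsSimplex f q)
    {G : Subgroup (V ≃ₗ[ZMod 2] V)} {p : ι} {c : V} (hc : c ∈ edges q)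
    (hG : formTransvection hf c ∈ G) :
    c ∈ edges (fun i : vertexBlock hf q G p => q i) ∨
      ∀ x ∈ Submodule.span (ZMod 2) (edges fun i : vertexBlock hf q G p => q i), f x c = 0 := by
  obtain ⟨a, b, rfl⟩ := hc
  by_cases ha : a ∈ vertexBlock hf q G p
  · exact .inl ⟨⟨a, ha⟩, ⟨b, hq.mem_vertexBlock hf hG ha⟩, rfl⟩
  · refine .inr fun x => hq.form_eq_zero_of_notMem hf ha fun hb => ha ?_
    exact hq.mem_vertexBlock hf (add_comm (q a) (q b) ▸ hG) hb

theorem IsSimplex.exists_subset_edges_vertexBlock (hf : f.IsAlt) (hnd : f.Nondegenerate)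
    (hq : IsSimplex f q) (hB : B ⊆ edges q)
    (hirr : (naturalRep
      (restrictTo (transvectionGroup hf B) (Submodule.span (ZMod 2) B))).IsIrreducible)
    (hdis : Disjoint (Submodule.span (ZMod 2) B) (f.orthogonal (Submodule.span (ZMod 2) B))) :
    ∃ p, B ⊆ edges fun i : vertexBlock hf q (transvectionGroup hf B) p => q i := by
  set G := transvectionGroup hf B
  obtain ⟨hW, hL⟩ := (isIrreducible_restrictTo_iff
    (transvectionGroup_le_stabilizer hf Submodule.subset_span)).1 hirr
  obtain ⟨u, huB, hu0⟩ : ∃ u ∈ B, u ≠ 0 := by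
    by_contra! h
    exact hW (Submodule.span_eq_bot.2 h)
  obtain ⟨p', p, rfl⟩ := hB huB
  refine ⟨p, ?_⟩
  set E := edges fun i : vertexBlock hf q G p => q i
  have hp' : p' ∈ vertexBlock hf q G p := formTransvection_mem_transvectionGroup hf huB
  have hEW : Submodule.span (ZMod 2) E ≤ Submodule.span (ZMod 2) B :=
    Submodule.span_le.2 fun c hc => mem_span_of_formTransvection_mem hf hnd
      (hq.formTransvection_mem_of_mem_edges_vertexBlock hf hc)
  have hsplit (c : V) (hc : c ∈ B) : c ∈ E ∨ ∀ x ∈ Submodule.span (ZMod 2) E, f x c = 0 :=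
    hq.mem_edges_vertexBlock_or_form_eq_zero hf (hB hc)
      (formTransvection_mem_transvectionGroup hf hc)
  have hEB : Submodule.span (ZMod 2) E = Submodule.span (ZMod 2) B := by
    refine (hL _ hEW ((transvectionGroup_le_iff hf).2 fun c hc => formTransvection_mem_stabilizer hf
      ((hsplit c hc).imp_left (Submodule.subset_span ·)))).resolve_left fun h => hu0 ?_
    exact Submodule.span_eq_bot.1 h _
      ⟨⟨p', hp'⟩, ⟨p, self_mem_vertexBlock hf G p⟩, rfl⟩
  intro c hc
  refine (hsplit c hc).elim id fun h => ?_
  have hc0 : c = 0 :=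
    Submodule.disjoint_def.1 hdis c (Submodule.subset_span hc) fun x hx => h x (hEB ▸ hx)
  exact ⟨⟨p', hp'⟩, ⟨p', hp'⟩, hc0.trans (ZModModule.add_self _).symm⟩

theorem IsSimplex.odd_card_of_disjoint_orthogonal (hf : f.IsAlt) (hq : IsSimplex f q)
    {C : Finset ι} {p : ι} (hp : p ∈ C)
    (hdis : Disjoint (Submodule.span (ZMod 2) (edges fun i : C => q i))
      (f.orthogonal (Submodule.span (ZMod 2) (edges fun i : C => q i))))
    (hne : Submodule.span (ZMod 2) (edges fun i : C => q i) ≠ Submodule.span (ZMod 2) (edges q)) :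
    Odd C.card := by
  classical
  by_contra heven
  have hcard : (C.card : ZMod 2) = 0 :=
    (ZMod.natCast_eq_zero_iff_even).2 (Nat.not_odd_iff_even.1 heven)
  set s := ∑ i ∈ C, (q i + q p)
  have hs (k l : ι) : f s (q k + q l) = (if k ∈ C then 1 else 0) + if l ∈ C then 1 else 0 := by
    simp only [s, map_sum, LinearMap.sum_apply, hq.form_edge_edge hf]
    simp [Finset.sum_add_distrib, hcard]
  have hs0 : s = 0 := by
    refine Submodule.disjoint_def.1 hdis s
      (Submodule.sum_mem _ fun i hi => Submodule.subset_span ⟨⟨i, hi⟩, ⟨p, hp⟩, rfl⟩) ?_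
    refine mem_orthogonal_span_iff.2 ?_
    rintro _ ⟨i, j, rfl⟩
    rw [form_comm hf, hs, if_pos i.2, if_pos j.2, CharTwo.add_self_eq_zero]
  have huniv (k : ι) : k ∈ C := by
    by_contra hk
    have := hs k p
    simp [hs0, hk, hp] at this
  refine hne (congrArg _ (Set.Subset.antisymm ?_ ?_))
  · rintro _ ⟨i, j, rfl⟩
    exact ⟨i, j, rfl⟩
  · rintro _ ⟨i, j, rfl⟩
    exact ⟨⟨i, huniv i⟩, ⟨j, huniv j⟩, rfl⟩

theorem IsSimplex.hasOddSymmetricType_restrictTo [Finite ι] (hf : f.IsAlt)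
    (hnd : f.Nondegenerate) (hq : IsSimplex f q) (hB : B ⊆ edges q)
    (hne : Submodule.span (ZMod 2) B ≠ Submodule.span (ZMod 2) (edges q))
    (h2 : 2 ≤ Module.finrank (ZMod 2) (Submodule.span (ZMod 2) B))
    (hirr : (naturalRep
      (restrictTo (transvectionGroup hf B) (Submodule.span (ZMod 2) B))).IsIrreducible) :
    HasOddSymmetricType (restrictTo (transvectionGroup hf B) (Submodule.span (ZMod 2) B)) := by
  have hdis := disjoint_orthogonal_of_isIrreducible hf hirr h2
  obtain ⟨p, hBp⟩ := hq.exists_subset_edges_vertexBlock hf hnd hB hirr hdis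
  have hG (c : V) := hq.formTransvection_mem_of_mem_edges_vertexBlock hf (p := p) (c := c)
    (G := transvectionGroup hf B)
  have hp := self_mem_vertexBlock hf (q := q) (transvectionGroup hf B) p
  generalize vertexBlock hf q (transvectionGroup hf B) p = C at hBp hG hp
  lift C to Finset ι using Set.toFinite C
  have hspan : Submodule.span (ZMod 2) (edges fun i : C => q i) = Submodule.span (ZMod 2) B :=
    le_antisymm (Submodule.span_le.2 fun c hc => mem_span_of_formTransvection_mem hf hnd (hG c hc))
      (Submodule.span_mono hBp)
  have : Nonempty C := ⟨⟨p, hp⟩⟩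
  refine ⟨_, ?_, (hq.comp_injective Subtype.val_injective).isSymmetricOfDegree_restrictTo
    hf hnd (ι := C) hBp hG hdis⟩
  rw [Nat.card_eq_fintype_card, Fintype.card_coe]
  exact hq.odd_card_of_disjoint_orthogonal hf hp (by rwa [hspan]) (by rwa [hspan])

end VertexBlocks

section Pencils

variable {V ι : Type*} [AddCommGroup V] [Module (ZMod 2) V] {f : LinearMap.BilinForm (ZMod 2) V}
  {q : ι → V} {a b c : V}

/-- A description, not mentioning any simplex, of the edges `q p + q z` through the common vertex
`p` of two edges `a = q p + q s` and `b = q p + q t` of a simplex. The edge `a + b = q s + q t`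
closing the triangle is the only other one that is non-orthogonal to both `a` and `b`. -/
def pencil (f : LinearMap.BilinForm (ZMod 2) V) (a b : V) : Set V :=
  {c | c = 0 ∨ c = a ∨ c = b ∨ (f c a = 1 ∧ f c b = 1 ∧ c ≠ a + b)}

theorem IsSimplex.exists_common_vertex (hf : f.IsAlt) (hq : IsSimplex f q) (ha : a ∈ edges q)
    (hb : b ∈ edges q) (hab : f a b = 1) :
    ∃ p s t, p ≠ s ∧ p ≠ t ∧ s ≠ t ∧ a = q p + q s ∧ b = q p + q t := by
  classical
  obtain ⟨p, s, t, rfl, rfl⟩ : ∃ p s t, a = q p + q s ∧ b = q p + q t := by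
    obtain ⟨i, j, rfl⟩ := ha
    obtain ⟨k, l, rfl⟩ := hb
    rw [hq.form_edge_edge hf] at hab
    rcases eq_or_ne i k with rfl | hik
    · exact ⟨i, j, l, rfl, rfl⟩
    rcases eq_or_ne i l with rfl | hil
    · exact ⟨i, j, k, rfl, add_comm _ _⟩
    rcases eq_or_ne j k with rfl | hjk
    · exact ⟨j, i, l, add_comm _ _, rfl⟩
    rcases eq_or_ne j l with rfl | hjl
    · exact ⟨j, i, k, add_comm _ _, add_comm _ _⟩
    simp [hik, hil, hjk, hjl] at hab
  refine ⟨p, s, t, ?_, ?_, ?_, rfl, rfl⟩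
  · rintro rfl
    simp [ZModModule.add_self] at hab
  · rintro rfl
    simp [ZModModule.add_self] at hab
  · rintro rfl
    simp [-map_add, hf (q p + q s)] at hab

theorem IsSimplex.exists_eq_of_mem_pencil (hf : f.IsAlt) (hq : IsSimplex f q) {p s t : ι}
    (hps : p ≠ s) (hpt : p ≠ t) (hst : s ≠ t) (hc : c ∈ edges q)
    (hcp : c ∈ pencil f (q p + q s) (q p + q t)) : ∃ z, c = q p + q z := by
  classical
  rcases hcp with rfl | rfl | rfl | ⟨hca, hcb, hcab⟩
  · exact ⟨p, (ZModModule.add_self _).symm⟩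
  · exact ⟨s, rfl⟩
  · exact ⟨t, rfl⟩
  obtain ⟨x, y, rfl⟩ := hc
  rcases eq_or_ne x p with rfl | hxp
  · exact ⟨y, rfl⟩
  rcases eq_or_ne y p with rfl | hyp
  · exact ⟨x, add_comm _ _⟩
  rw [add_comm (q p), add_comm (q p), add_add_add_self] at hcab
  rw [hq.form_edge_edge hf] at hca hcb
  grind [add_comm]

theorem IsSimplex.mem_pencil {k : ℕ} (hk : Odd k) {q : Fin k → V} (hf : f.IsAlt)
    (hq : IsSimplex f q) {p s t : Fin k} (hps : p ≠ s) (hpt : p ≠ t) (hst : s ≠ t) (z : Fin k) :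
    q p + q z ∈ pencil f (q p + q s) (q p + q t) := by
  rcases eq_or_ne z p with rfl | hzp
  · exact .inl (ZModModule.add_self _)
  rcases eq_or_ne z s with rfl | hzs
  · exact .inr (.inl rfl)
  rcases eq_or_ne z t with rfl | hzt
  · exact .inr (.inr (.inl rfl))
  refine .inr (.inr (.inr ⟨?_, ?_, fun h => ?_⟩))
  · simp [-map_add, hq.form_edge_edge hf, hps, hzp, hzs]
  · simp [-map_add, hq.form_edge_edge hf, hpt, hzp, hzt]
  have hcard : ({p, s, t, z} : Finset (Fin k)).card = 4 := by
    simp [hps, hpt, hst, hzp.symm, hzs.symm, hzt.symm]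
  have hle : 4 ≤ k := by simpa [hcard] using Finset.card_le_univ ({p, s, t, z} : Finset (Fin k))
  have hk4 : k ≠ 4 := by
    rintro rfl
    exact absurd hk (by decide)
  obtain ⟨w, hw⟩ := exists_fin_notMem (s := {p, s, t, z}) (by lia)
  simp only [Finset.mem_insert, Finset.mem_singleton, not_or] at hw
  rw [add_comm (q p) (q s), add_comm (q p) (q t), add_add_add_self] at h
  have htest := congrArg (f (q z + q w)) h
  rw [hq.form_edge_edge hf, hq.form_edge_edge hf] at htest
  simp [hw, hzp, hzs, hzt] at htest

theorem IsSimplex.exists_mem_pencil_iff {k : ℕ} (hk : Odd k) {q : Fin k → V} (hf : f.IsAlt)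
    (hq : IsSimplex f q) (ha : a ∈ edges q) (hb : b ∈ edges q) (hab : f a b = 1) :
    ∃ p, ∀ c ∈ edges q, c ∈ pencil f a b ↔ ∃ z, c = q p + q z := by
  obtain ⟨p, s, t, hps, hpt, hst, rfl, rfl⟩ := hq.exists_common_vertex hf ha hb hab
  refine ⟨p, fun c hc => ⟨hq.exists_eq_of_mem_pencil hf hps hpt hst hc, ?_⟩⟩
  rintro ⟨z, rfl⟩
  exact hq.mem_pencil hk hf hps hpt hst z

end Pencils

section LocalToGlobal

variable {V : Type*} [AddCommGroup V] [Module (ZMod 2) V] {f : LinearMap.BilinForm (ZMod 2) V}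
  {S : Set V} {A B : Finset V} {a b c : V} {m n N : ℕ}

/-- Condition (2) of the theorem, with an arbitrary bound `N` on the size of the subsets. -/
def IsLocallyOddSymmetric (T : Set (V ≃ₗ[ZMod 2] V)) (N : ℕ) : Prop :=
  ∀ T₀ : Finset (V ≃ₗ[ZMod 2] V), (T₀ : Set (V ≃ₗ[ZMod 2] V)) ⊆ T → T₀.card ≤ N →
    ∀ (G₀ : Subgroup (V ≃ₗ[ZMod 2] V)) (V₀ : Submodule (ZMod 2) V),
      G₀ = Subgroup.closure (T₀ : Set (V ≃ₗ[ZMod 2] V)) →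
      V₀ = commutatorSpace G₀ →
      2 ≤ Module.finrank (ZMod 2) V₀ →
      (naturalRep (restrictTo G₀ V₀)).IsIrreducible →
      HasOddSymmetricType (restrictTo G₀ V₀)

/-- The subsets of `S` with at most `n` elements that are connected in the graph of
non-orthogonality. -/
def linkedSubsets (hf : f.IsAlt) (S : Set V) (n : ℕ) : Set (Finset V) :=
  {B | ↑B ⊆ S ∧ B.card ≤ n ∧ ((nonorthogonalityGraph hf).induce (B : Set V)).Preconnected}

open Classical in
theorem union_mem_linkedSubsets {hf : f.IsAlt} (hA : A ∈ linkedSubsets hf S m)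
    (hB : B ∈ linkedSubsets hf S n) (haA : a ∈ A) (haB : a ∈ B) :
    A ∪ B ∈ linkedSubsets hf S (m + n) := by
  obtain ⟨hAS, hAm, hA⟩ := hA
  obtain ⟨hBS, hBn, hB⟩ := hB
  refine ⟨?_, (Finset.card_union_le A B).trans (Nat.add_le_add hAm hBn), ?_⟩
  · rw [Finset.coe_union]
    exact Set.union_subset hAS hBS
  · rw [Finset.coe_union]
    exact (SimpleGraph.induce_union_connected hA hB ⟨a, haA, haB⟩).preconnected

open Classical in
theorem pair_mem_linkedSubsets (hf : f.IsAlt) (ha : a ∈ S) (hb : b ∈ S) (hab : f a b = 1) :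
    {a, b} ∈ linkedSubsets hf S 2 := by
  refine ⟨?_, Finset.card_le_two, ?_⟩
  · rw [Finset.coe_pair]
    exact Set.pair_subset ha hb
  · rw [Finset.coe_pair]
    exact (SimpleGraph.connected_induce_union (s := {a}) (t := {b}) .of_subsingleton
      .of_subsingleton rfl rfl (hab ▸ one_ne_zero : f a b ≠ 0)).preconnected

theorem exists_isSimplex_of_hasOddSymmetricType_restrictTo {B : Set V} (hf : f.IsAlt)
    (hnd : f.Nondegenerate) [FiniteDimensional (ZMod 2) V]
    (hdis : Disjoint (Submodule.span (ZMod 2) B) (f.orthogonal (Submodule.span (ZMod 2) B)))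
    (hne : Submodule.span (ZMod 2) B ≠ ⊥)
    (hodd : HasOddSymmetricType
      (restrictTo (transvectionGroup hf B) (Submodule.span (ZMod 2) B))) :
    ∃ k, Odd k ∧ ∃ q : Fin k → V, IsSimplex f q ∧
      ∀ c, formTransvection hf c ∈ transvectionGroup hf B ↔ c ∈ edges q := by
  obtain ⟨k, hk, hG⟩ := hodd
  set W := Submodule.span (ZMod 2) B
  have := (Submodule.nontrivial_iff_ne_bot).2 hne
  have hle : restrictTo (transvectionGroup hf B) W ≤ isometrySubgroup (f.restrict W) := by
    rw [restrictTo_transvectionGroup hf Submodule.subset_span]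
    exact transvectionGroup_le_isometrySubgroup _ _
  obtain ⟨q, hq, -, hqG⟩ := exists_isSimplex_of_isSymmetricOfDegree (restrict_isAlt hf W)
    (LinearMap.BilinForm.nondegenerate_restrict_of_disjoint_orthogonal f hf.isRefl hdis)
    hle hG (.inl hk)
  have hcod : Codisjoint W (f.orthogonal W) :=
    ((LinearMap.BilinForm.isCompl_orthogonal_iff_disjoint hf.isRefl).2 hdis).codisjoint
  have hmem (c : W) :=
    (formTransvection_mem_restrictTo_iff hf Submodule.subset_span hcod c).symm.trans (hqG c)
  refine ⟨k, hk, fun i => q i, fun i j o => hq i j o, fun c => ⟨fun hc => ?_, ?_⟩⟩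
  · obtain ⟨i, j, hij⟩ := (hmem ⟨c, mem_span_of_formTransvection_mem hf hnd hc⟩).1 hc
    exact ⟨i, j, congrArg Subtype.val hij⟩
  · rintro ⟨i, j, rfl⟩
    exact (hmem (q i + q j)).2 (mem_edges i j)

theorem IsLocallyOddSymmetric.hasOddSymmetricType_restrictTo (hf : f.IsAlt) (hnd : f.Nondegenerate)
    (h : IsLocallyOddSymmetric (formTransvection hf '' S) N) (hB : B ∈ linkedSubsets hf S N)
    (hdis : Disjoint (Submodule.span (ZMod 2) (B : Set V))
      (f.orthogonal (Submodule.span (ZMod 2) (B : Set V))))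
    (hne : Submodule.span (ZMod 2) (B : Set V) ≠ ⊥) :
    HasOddSymmetricType
      (restrictTo (transvectionGroup hf (B : Set V)) (Submodule.span (ZMod 2) (B : Set V))) := by
  classical
  refine h (B.image (formTransvection hf)) ?_ (Finset.card_image_le.trans hB.2.1) _ _ ?_
    (commutatorSpace_transvectionGroup hf hnd _).symm
    (two_le_finrank_of_disjoint_orthogonal hf hdis hne)
    (isIrreducible_of_preconnected hf hB.2.2 hdis hne)
  · rw [Finset.coe_image]
    exact Set.image_mono hB.1
  · rw [Finset.coe_image, transvectionGroup]

theorem IsLocallyOddSymmetric.exists_isSimplex [FiniteDimensional (ZMod 2) V] (hf : f.IsAlt)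
    (hnd : f.Nondegenerate) (h : IsLocallyOddSymmetric (formTransvection hf '' S) N)
    (hS : ∀ r, r ≠ 0 → ∃ u ∈ S, f u r ≠ 0) (hA : A ∈ linkedSubsets hf S n) (hn : n + n ≤ N)
    (ha : a ∈ A) (ha0 : a ≠ 0) :
    ∃ B ∈ linkedSubsets hf S (n + n), A ⊆ B ∧ ∃ k, Odd k ∧ ∃ q : Fin k → V, IsSimplex f q ∧
      ∀ c, formTransvection hf c ∈ transvectionGroup hf (B : Set V) ↔ c ∈ edges q := by
  obtain ⟨hAS, hAn, hA⟩ := hA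
  have hrad : Module.finrank (ZMod 2) (Submodule.span (ZMod 2) (A : Set V) ⊓
      f.orthogonal (Submodule.span (ZMod 2) (A : Set V)) : Submodule (ZMod 2) V) ≤ n :=
    (Submodule.finrank_mono inf_le_left).trans ((finrank_span_finset_le_card A).trans hAn)
  obtain ⟨B, hAB, hBS, hcard, hB, hdis⟩ :=
    exists_preconnected_disjoint_orthogonal hf hS n A hAS hA hrad
  have hBn : B.card ≤ n + n := hcard.trans (Nat.add_le_add_right hAn n)
  have hne : Submodule.span (ZMod 2) (B : Set V) ≠ ⊥ := fun hbot =>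
    ha0 (Submodule.span_eq_bot.1 hbot a (hAB ha))
  exact ⟨B, ⟨hBS, hBn, hB⟩, hAB, exists_isSimplex_of_hasOddSymmetricType_restrictTo hf hnd hdis hne
    (h.hasOddSymmetricType_restrictTo hf hnd ⟨hBS, hBn.trans hn, hB⟩ hdis hne)⟩

theorem IsLocallyOddSymmetric.exists_vertex [FiniteDimensional (ZMod 2) V] (hf : f.IsAlt)
    (hnd : f.Nondegenerate) (h : IsLocallyOddSymmetric (formTransvection hf '' S) N)
    (hS : ∀ r, r ≠ 0 → ∃ u ∈ S, f u r ≠ 0) (hA : A ∈ linkedSubsets hf S n) (hn : n + n ≤ N)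
    (ha : a ∈ A) (hb : b ∈ A) (hab : f a b = 1) :
    ∃ B ∈ linkedSubsets hf S (n + n), A ⊆ B ∧ ∃ k, ∃ q : Fin k → V, IsSimplex f q ∧
      (∀ c, formTransvection hf c ∈ transvectionGroup hf (B : Set V) ↔ c ∈ edges q) ∧
      ∃ p, ∀ c ∈ edges q, c ∈ pencil f a b ↔ ∃ z, c = q p + q z := by
  have ha0 : a ≠ 0 := by
    rintro rfl
    simp at hab
  obtain ⟨B, hB, hAB, k, hk, q, hq, hG⟩ := h.exists_isSimplex hf hnd hS hA hn ha ha0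
  have hmem {c : V} (hc : c ∈ A) : c ∈ edges q :=
    (hG c).1 (formTransvection_mem_transvectionGroup hf (hAB hc))
  exact ⟨B, hB, hAB, k, q, hq, hG, hq.exists_mem_pencil_iff hk hf (hmem ha) (hmem hb) hab⟩

/-- The members of the pencil of `a` and `b` that are witnessed by a small linked subset of `S`
containing `a` and `b`. If a global simplex exists, these are its edges at the common vertex of `a`
and `b`; the bound `12` is what writing an element of `S` as a sum of two members costs. -/
def localPencil (hf : f.IsAlt) (S : Set V) (a b : V) : Set V :=
  {c ∈ pencil f a b | ∃ B ∈ linkedSubsets hf S 12, a ∈ B ∧ b ∈ B ∧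
    formTransvection hf c ∈ transvectionGroup hf (B : Set V)}

theorem formTransvection_mem_of_mem_localPencil {hf : f.IsAlt} (hc : c ∈ localPencil hf S a b) :
    formTransvection hf c ∈ transvectionGroup hf S := by
  obtain ⟨-, B, hB, -, -, hcB⟩ := hc
  exact transvectionGroup_mono hf hB.1 hcB

theorem zero_mem_localPencil (hf : f.IsAlt) (ha : a ∈ S) (hb : b ∈ S) (hab : f a b = 1) :
    0 ∈ localPencil hf S a b := by
  classical
  obtain ⟨hS, hcard, hconn⟩ := pair_mem_linkedSubsets hf ha hb hab
  refine ⟨.inl rfl, {a, b}, ⟨hS, hcard.trans (by norm_num), hconn⟩, by simp, by simp, ?_⟩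
  rw [formTransvection_zero]
  exact Subgroup.one_mem _

theorem IsLocallyOddSymmetric.form_eq_one_of_mem_localPencil [FiniteDimensional (ZMod 2) V]
    (hf : f.IsAlt) (hnd : f.Nondegenerate)
    (h : IsLocallyOddSymmetric (formTransvection hf '' S) N) (hN : 48 ≤ N)
    (hS : ∀ r, r ≠ 0 → ∃ u ∈ S, f u r ≠ 0) (hab : f a b = 1) {d : V}
    (hc : c ∈ localPencil hf S a b) (hd : d ∈ localPencil hf S a b) (hc0 : c ≠ 0) (hd0 : d ≠ 0)
    (hcd : c ≠ d) : f c d = 1 := by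
  classical
  obtain ⟨hcp, C, hC, haC, hbC, hcC⟩ := hc
  obtain ⟨hdp, D, hD, haD, -, hdD⟩ := hd
  obtain ⟨B, -, hB, k, q, hq, hG, p, hp⟩ := h.exists_vertex hf hnd hS
    (union_mem_linkedSubsets hC hD haC haD) hN (Finset.mem_union_left D haC)
    (Finset.mem_union_left D hbC) hab
  obtain ⟨hCB, hDB⟩ := Finset.union_subset_iff.1 hB
  have hcq := (hG c).1 (transvectionGroup_mono hf (Finset.coe_subset.2 hCB) hcC)
  have hdq := (hG d).1 (transvectionGroup_mono hf (Finset.coe_subset.2 hDB) hdD)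
  obtain ⟨x, rfl⟩ := (hp c hcq).1 hcp
  obtain ⟨y, rfl⟩ := (hp d hdq).1 hdp
  have hne {z : Fin k} (hz : q p + q z ≠ 0) : z ≠ p := by
    rintro rfl
    exact hz (ZModModule.add_self _)
  rw [add_comm (q p), add_comm (q p)]
  exact hq x y p (fun hxy => hcd (hxy ▸ rfl)) (hne hc0) (hne hd0)

theorem IsLocallyOddSymmetric.isSimplex_localPencil [FiniteDimensional (ZMod 2) V]
    (hf : f.IsAlt) (hnd : f.Nondegenerate)
    (h : IsLocallyOddSymmetric (formTransvection hf '' S) N) (hN : 48 ≤ N)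
    (hS : ∀ r, r ≠ 0 → ∃ u ∈ S, f u r ≠ 0) (ha : a ∈ S) (hb : b ∈ S) (hab : f a b = 1) :
    IsSimplex f (Subtype.val : localPencil hf S a b → V) := by
  refine isSimplex_of_base hf ⟨0, zero_mem_localPencil hf ha hb hab⟩ fun c d hc0 hd0 hcd => ?_
  rw [add_zero, add_zero]
  exact h.form_eq_one_of_mem_localPencil hf hnd hN hS hab c.2 d.2 (Subtype.coe_ne_coe.2 hc0)
    (Subtype.coe_ne_coe.2 hd0) (Subtype.coe_ne_coe.2 hcd)

theorem IsLocallyOddSymmetric.mem_edges_localPencil [FiniteDimensional (ZMod 2) V]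
    (hf : f.IsAlt) (hnd : f.Nondegenerate)
    (h : IsLocallyOddSymmetric (formTransvection hf '' S) N) (hN : 12 ≤ N)
    (hS : ∀ r, r ≠ 0 → ∃ u ∈ S, f u r ≠ 0) (ha : a ∈ S) (hb : b ∈ S) (hab : f a b = 1) {u r : V}
    (hu : u ∈ S) (hr : r ∈ S) (hub : f u b = 1) (hur : f u r = 1) :
    r ∈ edges (Subtype.val : localPencil hf S a b → V) := by
  classical
  have hA : {a, b} ∪ ({b, u} ∪ {u, r}) ∈ linkedSubsets hf S 6 :=
    union_mem_linkedSubsets (a := b) (pair_mem_linkedSubsets hf ha hb hab)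
      (union_mem_linkedSubsets (a := u)
        (pair_mem_linkedSubsets hf hb hu ((form_comm hf b u).trans hub))
        (pair_mem_linkedSubsets hf hu hr hur) (by simp) (by simp)) (by simp) (by simp)
  obtain ⟨B, hB, hAB, k, q, -, hG, p, hp⟩ := h.exists_vertex hf hnd hS hA hN
    (a := a) (b := b) (by simp) (by simp) hab
  have hpencil (z : Fin k) : q p + q z ∈ localPencil hf S a b :=
    ⟨(hp _ (mem_edges p z)).2 ⟨z, rfl⟩, B, hB, hAB (by simp), hAB (by simp),
      (hG _).2 (mem_edges p z)⟩
  obtain ⟨x, y, rfl⟩ := (hG r).1 (formTransvection_mem_transvectionGroup hf (hAB (by simp)))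
  refine ⟨⟨_, hpencil x⟩, ⟨_, hpencil y⟩, ?_⟩
  change q x + q y = q p + q x + (q p + q y)
  rw [add_comm (q p), add_comm (q p), add_add_add_self]

theorem IsLocallyOddSymmetric.hasSymmetricType [FiniteDimensional (ZMod 2) V] [Nontrivial V]
    (hf : f.IsAlt) (hnd : f.Nondegenerate) (hdense : IsDenseSet (formTransvection hf '' S))
    (h : IsLocallyOddSymmetric (formTransvection hf '' S) N) (hN : 48 ≤ N) :
    HasSymmetricType (transvectionGroup hf S) := by
  have hex {v w : V} (hv : v ≠ 0) (hw : w ≠ 0) : ∃ u ∈ S, f u v = 1 ∧ f u w = 1 :=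
    exists_mem_form_eq_one_of_isDenseSet hf hnd hdense hv hw
  have hS (r : V) (hr : r ≠ 0) : ∃ u ∈ S, f u r ≠ 0 :=
    let ⟨u, hu, hur, _⟩ := hex hr hr
    ⟨u, hu, hur ▸ one_ne_zero⟩
  have hne {x y : V} (hxy : f x y = 1) : x ≠ 0 := by
    rintro rfl
    simp at hxy
  obtain ⟨v, hv⟩ := exists_ne (0 : V)
  obtain ⟨b, hb, hbv, -⟩ := hex hv hv
  obtain ⟨a, ha, hab, -⟩ := hex (hne hbv) (hne hbv)
  have h0 := zero_mem_localPencil hf ha hb hab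
  have hq := h.isSimplex_localPencil hf hnd hN hS ha hb hab
  have hSq : S ⊆ edges (Subtype.val : localPencil hf S a b → V) := by
    intro r hr
    rcases eq_or_ne r 0 with rfl | hr0
    · exact ⟨⟨0, h0⟩, ⟨0, h0⟩, (add_zero 0).symm⟩
    · obtain ⟨u, hu, hub, hur⟩ := hex (hne hbv) hr0
      exact h.mem_edges_localPencil hf hnd (by lia) hS ha hb hab hu hr hub hur
  have hspan : Submodule.span (ZMod 2) (edges (Subtype.val : localPencil hf S a b → V)) = ⊤ :=
    top_unique ((span_eq_top_of_forall_exists_form_ne_zero hf hnd hS).ge.trans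
      (Submodule.span_mono hSq))
  have : Finite V := Module.finite_of_finite (ZMod 2)
  refine ⟨_, hq.isSymmetricOfDegree hf hnd hspan hSq fun c hc =>
    hq.formTransvection_mem_of_base hf (o := ⟨0, h0⟩) (fun i => ?_) hc⟩
  rw [add_zero]
  exact formTransvection_mem_of_mem_localPencil i.2

end LocalToGlobal

section GlobalToLocal

variable {V : Type*} [AddCommGroup V] [Module (ZMod 2) V] {f : LinearMap.BilinForm (ZMod 2) V}
  {S : Set V} {N : ℕ}

theorem HasSymmetricType.isLocallyOddSymmetric (hf : f.IsAlt) (hnd : f.Nondegenerate)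
    (h5 : 5 ≤ Module.finrank (ZMod 2) V) (hN : N < Module.finrank (ZMod 2) V)
    (h : HasSymmetricType (transvectionGroup hf S)) :
    IsLocallyOddSymmetric (formTransvection hf '' S) N := by
  classical
  have : Nontrivial V := Module.nontrivial_of_finrank_pos (R := ZMod 2) (by lia)
  obtain ⟨m, hm⟩ := h
  obtain ⟨q, hq, hspan, hG⟩ := exists_isSimplex_of_isSymmetricOfDegree hf hnd
    (transvectionGroup_le_isometrySubgroup hf S) hm (.inr (h5.trans hm.finrank_le))
  rintro T₀ hT₀ hcard _ _ rfl rfl h2 hirr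
  obtain ⟨B, hBS, rfl⟩ := Finset.subset_set_image_iff.1 hT₀
  rw [Finset.card_image_of_injective _ (formTransvection_injective hf hnd)] at hcard
  rw [Finset.coe_image, ← transvectionGroup, commutatorSpace_transvectionGroup hf hnd] at h2 hirr ⊢
  have hne : Submodule.span (ZMod 2) (B : Set V) ≠ ⊤ := by
    intro htop
    have hle : Module.finrank (ZMod 2) (Submodule.span (ZMod 2) (B : Set V)) ≤ B.card :=
      finrank_span_finset_le_card B
    rw [htop, finrank_top] at hle
    lia
  exact hq.hasOddSymmetricType_restrictTo hf hnd
    (fun c hc => (hG c).1 (formTransvection_mem_transvectionGroup hf (hBS hc)))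
    (hspan.symm ▸ hne) h2 hirr

end GlobalToLocal

end SymType

open SymType in
theorem mainTheorem7_general {V : Type*} [AddCommGroup V] [Module (ZMod 2) V] {N : ℕ}
    (hN : 48 ≤ N) (hn : N < Module.finrank (ZMod 2) V)
    (f : LinearMap.BilinForm (ZMod 2) V) (hf_alt : f.IsAlt) (hf_nondeg : f.Nondegenerate)
    (T : Set (V ≃ₗ[ZMod 2] V))
    (hT : ∀ t ∈ T, IsTransvection t)
    (hTf : ∀ t ∈ T, ∀ x y : V, f (t x) (t y) = f x y)
    (hdense : IsDenseSet T) :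
    HasSymmetricType (Subgroup.closure T) ↔ IsLocallyOddSymmetric T N := by
  have : FiniteDimensional (ZMod 2) V := Module.finite_of_finrank_pos (by lia)
  have : Nontrivial V := Module.nontrivial_of_finrank_pos (R := ZMod 2) (by lia)
  have hT_range : T ⊆ Set.range (formTransvection hf_alt) := fun t ht =>
    let ⟨u, hu⟩ := exists_eq_formTransvection hf_alt hf_nondeg (hT t ht) (hTf t ht)
    ⟨u, hu.symm⟩
  obtain ⟨S, rfl⟩ := Set.subset_range_iff_exists_image_eq.1 hT_range
  exact ⟨HasSymmetricType.isLocallyOddSymmetric hf_alt hf_nondeg (by lia) hn,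
    fun h => h.hasSymmetricType hf_alt hf_nondeg hdense hN⟩

theorem mainTheorem7 {V : Type*} [AddCommGroup V] [Module (ZMod 2) V]
    (hn : 2000 ≤ Module.finrank (ZMod 2) V)
    (f : LinearMap.BilinForm (ZMod 2) V) (hf_alt : f.IsAlt) (hf_nondeg : f.Nondegenerate)
    (T : Set (V ≃ₗ[ZMod 2] V))
    (hT : ∀ t ∈ T, SymType.IsTransvection t)
    (hTf : ∀ t ∈ T, ∀ x y : V, f (t x) (t y) = f x y)
    (hdense : SymType.IsDenseSet T) :
    SymType.HasSymmetricType (Subgroup.closure T) ↔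
      ∀ T₀ : Finset (V ≃ₗ[ZMod 2] V), (T₀ : Set (V ≃ₗ[ZMod 2] V)) ⊆ T → T₀.card ≤ 1000 →
        ∀ (G₀ : Subgroup (V ≃ₗ[ZMod 2] V)) (V₀ : Submodule (ZMod 2) V),
          G₀ = Subgroup.closure (T₀ : Set (V ≃ₗ[ZMod 2] V)) →
          V₀ = SymType.commutatorSpace G₀ →
          2 ≤ Module.finrank (ZMod 2) V₀ →
          (SymType.naturalRep (SymType.restrictTo G₀ V₀)).IsIrreducible →
          SymType.HasOddSymmetricType (SymType.restrictTo G₀ V₀) :=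
  mainTheorem7_general (by norm_num) (by lia) f hf_alt hf_nondeg T hT hTf hdense
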